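/- Let $m,n\in\mathbb N$, $q>1$, $p>1$, $\ell>0$, $q':=q/(q-1)$, and let $|\cdot|$ be the Euclidean norm on $\mathbb R^{m\times n}$. Let $\Psi:\mathbb R^{m\times n}\to[0,\infty)$ be continuous and suppose that for some $c>0$ $$\Big(\frac1c|\xi|^q-c\Big)\vee 0\le\Psi(\xi)\le c(|\xi|^q+1)\qquad\text{for all }\xi\in\mathbb R^{m\times n}.$$ A locally bounded Borel function $\Phi:\mathbb R^{m\times n}\to\mathbb R$ is called quasiconvex if $\Phi(\xi)\le\int_{Q_1}\Phi(\xi+\nabla\varphi)\,dx$ for all $\xi\in\mathbb R^{m\times n}$ and all $\varphi\in C_c^\infty(Q_1;\mathbb R^m)$, where $Q_1=(-\frac12,\frac12)^n$. The quasiconvex envelope of $h:\mathbb R^{m\times n}\to[0,\infty)$ is $h^{\rm qc}(\xi):=\sup\{\Phi(\xi):\Phi\le h,\ \Phi\text{ quasiconvex}\}$. For $\delta\in(0,1)$ let $$h_\delta(\xi):=\Psi(\xi)\wedge\frac{\ell}{(1-\delta^{q'})^{p-1}}\Psi^{1/q}(\xi).$$ Then for every $\xi\in\mathbb R^{m\times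 n}$ the map $\delta\mapsto h_\delta^{\rm qc}(\xi)$ is nondecreasing on $(0,1)$ and $$\sup_{\delta\in(0,1)}h_\delta^{\rm qc}(\xi)=\lim_{\delta\uparrow1}h_\delta^{\rm qc}(\xi)=\Psi^{\rm qc}(\xi).$$ Moreover, each $h_\delta^{\rm qc}$ has at most linear growth: for every $\delta\in(0,1)$ there is $C_\delta$ with $0\le h_\delta^{\rm qc}(\xi)\le C_\delta(|\xi|+1)$ for all $\xi\in\mathbb R^{m\times n}$. -/

import Mathlib

open Set Filter Topology MeasureTheory
open scoped ContDiff

/-- The Euclidean (Frobenius) norm of a matrix, `|ξ|² = ∑ ξ_{ij}²`. -/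
noncomputable def frobNorm {m n : ℕ} (ξ : Matrix (Fin m) (Fin n) ℝ) : ℝ :=
  Real.sqrt (∑ i, ∑ j, ξ i j ^ 2)

/-- The open unit cube `Q₁ = (-1/2, 1/2)ⁿ`. -/
def unitCube (n : ℕ) : Set (Fin n → ℝ) :=
  Set.univ.pi fun _ => Set.Ioo (-(1 / 2) : ℝ) (1 / 2)

/-- The gradient matrix `(∇φ(x))_{ij} = ∂_j φ_i(x)`. -/
noncomputable def gradMatrix {m n : ℕ} (φ : (Fin n → ℝ) → (Fin m → ℝ)) (x : Fin n → ℝ) :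
    Matrix (Fin m) (Fin n) ℝ :=
  Matrix.of fun i j => fderiv ℝ φ x (Pi.single j 1) i

/-- `φ ∈ C_c^∞(Q₁; ℝᵐ)` (extended by zero to `ℝⁿ`). -/
structure IsTestMap {m n : ℕ} (φ : (Fin n → ℝ) → (Fin m → ℝ)) : Prop where
  contDiff : ContDiff ℝ ∞ φ
  hasCompactSupport : HasCompactSupport φ
  tsupport_subset : tsupport φ ⊆ unitCube n

/-- Quasiconvexity of a locally bounded Borel function on `ℝ^{m×n}`. The integrals are those of
bounded Borel functions on a set of finite measure, hence they are genuine. -/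
structure IsQuasiconvex {m n : ℕ} (Φ : Matrix (Fin m) (Fin n) ℝ → ℝ) : Prop where
  measurable : Measurable[borel (Matrix (Fin m) (Fin n) ℝ)] Φ
  locallyBounded : ∀ R : ℝ, ∃ C : ℝ, ∀ ξ, frobNorm ξ ≤ R → |Φ ξ| ≤ C
  le_integral : ∀ (ξ : Matrix (Fin m) (Fin n) ℝ) (φ : (Fin n → ℝ) → (Fin m → ℝ)),
    IsTestMap φ → Φ ξ ≤ ∫ x in unitCube n, Φ (ξ + gradMatrix φ x)

/-- The quasiconvex envelope
`h^qc(ξ) = sup {Φ(ξ) : Φ ≤ h, Φ quasiconvex}`. -/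
noncomputable def qcEnvelope {m n : ℕ} (h : Matrix (Fin m) (Fin n) ℝ → ℝ)
    (ξ : Matrix (Fin m) (Fin n) ℝ) : ℝ :=
  sSup {t : ℝ | ∃ Φ : Matrix (Fin m) (Fin n) ℝ → ℝ,
    IsQuasiconvex Φ ∧ (∀ η, Φ η ≤ h η) ∧ t = Φ ξ}

/-- `h_δ = Ψ ∧ ℓ (1 - δ^{q'})^{1-p} Ψ^{1/q}` with `q' = q / (q - 1)`. -/
noncomputable def hDelta {m n : ℕ} (Ψ : Matrix (Fin m) (Fin n) ℝ → ℝ) (q p ℓ δ : ℝ)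
    (ξ : Matrix (Fin m) (Fin n) ℝ) : ℝ :=
  min (Ψ ξ) (ℓ / (1 - δ ^ (q / (q - 1))) ^ (p - 1) * Ψ ξ ^ (1 / q))

theorem isQuasiconvex_zero {m n : ℕ} :
    IsQuasiconvex (fun _ : Matrix (Fin m) (Fin n) ℝ => (0 : ℝ)) where
  measurable := @measurable_const _ _ _ (borel _) _
  locallyBounded := fun _ => ⟨0, fun _ _ => by simp⟩
  le_integral := fun _ _ _ => by simp

/-- For `h ≥ 0` the supremum defining `h^qc` is over a nonempty set bounded above, so that
`qcEnvelope` is the true supremum. -/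
theorem isLUB_qcEnvelope {m n : ℕ} {h : Matrix (Fin m) (Fin n) ℝ → ℝ} (hh : ∀ η, 0 ≤ h η)
    (ξ : Matrix (Fin m) (Fin n) ℝ) :
    IsLUB {t : ℝ | ∃ Φ : Matrix (Fin m) (Fin n) ℝ → ℝ,
      IsQuasiconvex Φ ∧ (∀ η, Φ η ≤ h η) ∧ t = Φ ξ} (qcEnvelope h ξ) := by
  refine isLUB_csSup ⟨0, fun _ => 0, isQuasiconvex_zero, hh, rfl⟩ ⟨h ξ, ?_⟩
  rintro t ⟨Φ, _, hle, rfl⟩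
  exact hle ξ

/-!
For `h ≥ 0` continuous and locally bounded, Dacorogna's formula
`testEnvelope h ξ = inf_φ ∫ h(ξ + ∇φ)` defines a quasiconvex function below `h`, so that
`testEnvelope h ≤ qcEnvelope h`. Hence an upper bound on `qcEnvelope h_δ ξ` yields test maps `φ`
with small energy `∫ h_δ(ξ + ∇φ)`. The claim follows once such a `φ` can be replaced by a test map
`ψ` for which `∫ Ψ(ξ + ∇ψ)` is not appreciably larger: every quasiconvex `Φ ≤ Ψ` then satisfies
`Φ(ξ) ≤ ∫ Ψ(ξ + ∇ψ)`. Here `h_δ` is `linearTrunc Ψ q K` with `K → ∞` as `δ ↑ 1`.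

The replacement is a Lipschitz truncation (`IsTestMap.exists_lipschitz_truncation`). Where the
maximal function of `|Dφ|` is at most `λ`, the map `φ` is Lipschitz with constant `C λ`. Extending
it from there, and mollifying, changes the gradient, in the limit, only on a set `U` with
`|U| ≤ (C / λ) ∫ (|Dφ| - λ / 2)⁺`, on which the new energy is at most `C λ^q |U|`. To make this
small, `λ` is chosen among dyadic levels `2 ^ j`, `j < J`: the sum of `λ^(q-1) (|Dφ| - λ / 2)⁺` over
these levels is bounded pointwise by `C (h_δ(ξ + ∇φ) + 1)`, with `C` independent of `J`, provided
`K` is large (`exists_sum_dyadic_le_linearTrunc`). Some level therefore contributes at most `C / J`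
(`exists_level_le`). On the complement of `U` the gradients are at most `λ ≤ 2 ^ J`, where
`Ψ = h_δ` once `K` is large.

Quasiconvexity of Dacorogna's formula (`testEnvelope_le_integral_testEnvelope`) is proved by
covering almost all of the cube by small disjoint cubes, centred at Lebesgue points of
`testEnvelope h (ξ + ∇φ)`, and adding rescaled nearly optimal competitors on finitely many of them.
With the sup norm on `ℝⁿ`, cubes are balls, so the covering theorems for balls apply directly.
-/

/-! ### The maximal function and mean oscillation -/

/-- The set of points at which all centred averages of `g` over sup-norm balls are at most `lam`,
i.e. the sublevel set `{M g ≤ lam}` of the Hardy–Littlewood maximal function. -/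
def maximalSublevel {n : ℕ} (g : (Fin n → ℝ) → ℝ) (lam : ℝ) : Set (Fin n → ℝ) :=
  {x | ∀ r : ℝ, 0 < r → ∫ z in Metric.closedBall x r, g z ≤ lam * (2 * r) ^ n}

theorem volume_real_closedBall_pi {n : ℕ} (x : Fin n → ℝ) {r : ℝ} (hr : 0 ≤ r) :
    volume.real (Metric.closedBall x r) = (2 * r) ^ n := by
  rw [Measure.real, Real.volume_pi_closedBall x hr, Fintype.card_fin,
    ENNReal.toReal_ofReal (by positivity)]

/-- The weak-type `(1,1)` inequality for the maximal function, in the sharpened form in which only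
the part of `g` above `lam / 2` enters. -/
theorem exists_measurable_superset_compl_maximalSublevel {n : ℕ} (hn : 0 < n) {g : (Fin n → ℝ) → ℝ}
    (hg : Integrable g) {lam : ℝ} (hl : 0 < lam)
    (hf : Integrable fun x => max (g x - lam / 2) 0) :
    ∃ U : Set (Fin n → ℝ), MeasurableSet U ∧ (maximalSublevel g lam)ᶜ ⊆ U ∧
      volume U ≤ ENNReal.ofReal (4 ^ n * (2 / lam * ∫ x, max (g x - lam / 2) 0)) := by
  set f : (Fin n → ℝ) → ℝ := fun x => max (g x - lam / 2) 0 with hfdef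
  have hf0 : ∀ x, 0 ≤ f x := fun x => le_max_right _ _
  have hex : ∀ x : Fin n → ℝ, ∃ r : ℝ, x ∈ (maximalSublevel g lam)ᶜ →
      0 < r ∧ lam * (2 * r) ^ n < ∫ z in Metric.closedBall x r, g z := by
    intro x
    by_cases hx : x ∈ (maximalSublevel g lam)ᶜ
    · simp only [maximalSublevel, mem_compl_iff, Set.mem_ofPred_eq, not_forall, not_le] at hx
      obtain ⟨r, hr, h⟩ := hx
      exact ⟨r, fun _ => ⟨hr, h⟩⟩
    · exact ⟨0, fun h => absurd h hx⟩
  choose r hr using hex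
  -- on a ball with mean above `lam`, at least half of the mass of `g` lies above `lam / 2`
  have key : ∀ x ∈ (maximalSublevel g lam)ᶜ,
      (2 * r x) ^ n ≤ 2 / lam * ∫ z in Metric.closedBall x (r x), f z := by
    intro x hx
    obtain ⟨hr0, hlt⟩ := hr x hx
    have h1 : ∫ z in Metric.closedBall x (r x), g z
        ≤ ∫ z in Metric.closedBall x (r x), (f z + lam / 2) := by
      refine integral_mono hg.integrableOn (hf.integrableOn.add ?_) fun z => ?_
      · exact integrableOn_const (by exact measure_closedBall_lt_top.ne) (by simp)
      · have : g z - lam / 2 ≤ f z := le_max_left _ _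
        simp only; linarith
    rw [integral_add hf.integrableOn
      (integrableOn_const (by exact measure_closedBall_lt_top.ne) (by simp))] at h1
    rw [setIntegral_const, volume_real_closedBall_pi x hr0.le, smul_eq_mul] at h1
    have h2 : lam / 2 * (2 * r x) ^ n ≤ ∫ z in Metric.closedBall x (r x), f z := by linarith
    calc (2 * r x) ^ n = 2 / lam * (lam / 2 * (2 * r x) ^ n) := by field_simp
      _ ≤ _ := by gcongr
  -- the radii are bounded because `0 < n`, as the Vitali lemma requires
  have hR : ∀ x ∈ (maximalSublevel g lam)ᶜ, r x ≤ 1 + 2 / lam * ∫ z, f z := by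
    intro x hx
    have h1 := key x hx
    have h2 : ∫ z in Metric.closedBall x (r x), f z ≤ ∫ z, f z :=
      setIntegral_le_integral hf (ae_of_all _ hf0)
    have h3 : 2 / lam * ∫ z in Metric.closedBall x (r x), f z ≤ 2 / lam * ∫ z, f z := by gcongr
    have h4 : 0 ≤ 2 / lam * ∫ z, f z := mul_nonneg (by positivity) (integral_nonneg hf0)
    have h5 := (hr x hx).1
    by_cases h6 : 2 * r x ≤ 1
    · linarith
    · have : 2 * r x ≤ (2 * r x) ^ n := le_self_pow₀ (not_le.mp h6).le hn.ne'
      linarith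
  obtain ⟨u, hu, hdisj, hcov⟩ := Vitali.exists_disjoint_subfamily_covering_enlargement_closedBall
    (maximalSublevel g lam)ᶜ (fun x => x) r _ hR 4 (by norm_num)
  have hcount : u.Countable := by
    refine hdisj.countable_of_nonempty_interior fun x hx => ?_
    exact ⟨x, Metric.ball_subset_interior_closedBall (Metric.mem_ball_self (hr x (hu hx)).1)⟩
  refine ⟨⋃ b ∈ u, Metric.closedBall b (4 * r b),
    MeasurableSet.biUnion hcount fun b _ => measurableSet_closedBall, fun x hx => ?_, ?_⟩
  · obtain ⟨b, hb, hsub⟩ := hcov x hx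
    exact mem_biUnion hb (hsub (Metric.mem_closedBall_self (hr x hx).1.le))
  · have hlin : ∀ b ∈ u, volume (Metric.closedBall b (4 * r b))
        ≤ ENNReal.ofReal (4 ^ n * (2 / lam)) *
          ∫⁻ z in Metric.closedBall b (r b), ENNReal.ofReal (f z) := by
      intro b hb
      have h0 := (hr b (hu hb)).1
      rw [Real.volume_pi_closedBall _ (by positivity), Fintype.card_fin,
        ← ofReal_integral_eq_lintegral_ofReal hf.integrableOn (ae_of_all _ hf0),
        ← ENNReal.ofReal_mul (by positivity)]
      apply ENNReal.ofReal_le_ofReal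
      calc (2 * (4 * r b)) ^ n = 4 ^ n * (2 * r b) ^ n := by rw [← mul_pow]; ring
        _ ≤ 4 ^ n * (2 / lam * ∫ z in Metric.closedBall b (r b), f z) := by
            gcongr; exact key b (hu hb)
        _ = _ := by ring
    have : Countable u := hcount.to_subtype
    calc volume (⋃ b ∈ u, Metric.closedBall b (4 * r b))
        ≤ ∑' b : u, volume (Metric.closedBall (b : Fin n → ℝ) (4 * r b)) :=
          measure_biUnion_le _ hcount _
      _ ≤ ∑' b : u, ENNReal.ofReal (4 ^ n * (2 / lam)) *
          ∫⁻ z in Metric.closedBall (b : Fin n → ℝ) (r b), ENNReal.ofReal (f z) :=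
          ENNReal.tsum_le_tsum fun b => hlin b b.2
      _ = ENNReal.ofReal (4 ^ n * (2 / lam)) *
          ∫⁻ z in ⋃ b ∈ u, Metric.closedBall b (r b), ENNReal.ofReal (f z) := by
          rw [ENNReal.tsum_mul_left, lintegral_biUnion hcount
            (fun b _ => measurableSet_closedBall) hdisj]
      _ ≤ ENNReal.ofReal (4 ^ n * (2 / lam)) * ∫⁻ z, ENNReal.ofReal (f z) := by
          gcongr; exact Measure.restrict_le_self
      _ = _ := by
          rw [← ofReal_integral_eq_lintegral_ofReal hf (ae_of_all _ hf0),
            ← ENNReal.ofReal_mul (by positivity), mul_assoc]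

/-- Where the maximal function of `|Dφ|` is at most `lam`, the mean oscillation of `φ` about its
value at the point is controlled by `lam` times the radius. -/
theorem setIntegral_norm_sub_le_of_mem_maximalSublevel {n m : ℕ}
    {φ : (Fin n → ℝ) → (Fin m → ℝ)} (hφ : ContDiff ℝ 1 φ) {lam : ℝ} {x : Fin n → ℝ}
    (hx : x ∈ maximalSublevel (fun y => ‖fderiv ℝ φ y‖) lam) {ρ : ℝ} (hρ : 0 < ρ) :
    ∫ z in Metric.closedBall x ρ, ‖φ x - φ z‖ ≤ ρ * lam * (2 * ρ) ^ n := by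
  set g : (Fin n → ℝ) → ℝ := fun y => ‖fderiv ℝ φ y‖ with hgdef
  have hgc : Continuous g := (hφ.continuous_fderiv one_ne_zero).norm
  set B := Metric.closedBall (0 : Fin n → ℝ) ρ with hB
  have hBc : IsCompact B := isCompact_closedBall _ _
  have htrans : ∀ (F : (Fin n → ℝ) → ℝ) (y : Fin n → ℝ) (s : ℝ),
      ∫ z in Metric.closedBall y s, F z = ∫ z in Metric.closedBall 0 s, F (y + z) := by
    intro F y s
    have := (measurePreserving_add_left (volume : Measure (Fin n → ℝ)) y).setIntegral_preimage_emb
      (measurableEmbedding_addLeft y) F (Metric.closedBall y s)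
    rw [← this]
    congr 2
    ext z; simp [dist_eq_norm]
  have hpt : ∀ z ∈ B, ‖φ x - φ (x + z)‖ ≤ ∫ t in Ioc (0 : ℝ) 1, ρ * g (x + t • z) := by
    intro z hz
    have hzn : ‖z‖ ≤ ρ := by simpa [hB] using hz
    have hd : ∀ t ∈ uIcc (0 : ℝ) 1,
        HasDerivAt (fun t : ℝ => φ (x + t • z)) (fderiv ℝ φ (x + t • z) z) t := by
      intro t _
      have h1 : HasFDerivAt φ (fderiv ℝ φ (x + t • z)) (x + t • z) :=
        ((hφ.differentiable one_ne_zero) _).hasFDerivAt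
      have h2 : HasDerivAt (fun t : ℝ => x + t • z) z t := by
        simpa using ((hasDerivAt_id t).smul_const z).const_add x
      exact h1.comp_hasDerivAt t h2
    have hc : Continuous fun t : ℝ => fderiv ℝ φ (x + t • z) z :=
      ((hφ.continuous_fderiv one_ne_zero).comp (by fun_prop)).clm_apply continuous_const
    have hftc := intervalIntegral.integral_eq_sub_of_hasDerivAt hd (hc.intervalIntegrable _ _)
    simp only [one_smul, zero_smul, add_zero] at hftc
    rw [norm_sub_rev, ← hftc, ← intervalIntegral.integral_of_le zero_le_one]
    refine intervalIntegral.norm_integral_le_of_norm_le zero_le_one (ae_of_all _ fun t _ => ?_)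
      ((continuous_const.mul (hgc.comp (by fun_prop))).intervalIntegrable _ _)
    calc ‖fderiv ℝ φ (x + t • z) z‖ ≤ ‖fderiv ℝ φ (x + t • z)‖ * ‖z‖ :=
          ContinuousLinearMap.le_opNorm _ _
      _ ≤ ‖fderiv ℝ φ (x + t • z)‖ * ρ := by gcongr
      _ = _ := mul_comm _ _
  have hcont2 : Continuous (Function.uncurry fun (z : Fin n → ℝ) (t : ℝ) => ρ * g (x + t • z)) :=
    continuous_const.mul (hgc.comp (by fun_prop))
  have hint2 : Integrable (Function.uncurry fun (z : Fin n → ℝ) (t : ℝ) => ρ * g (x + t • z))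
      ((volume.restrict B).prod (volume.restrict (Ioc (0 : ℝ) 1))) := by
    rw [Measure.prod_restrict]
    exact (hcont2.continuousOn.integrableOn_compact (hBc.prod isCompact_Icc)).mono_set
      (prod_mono_right Ioc_subset_Icc_self)
  have hscale : ∀ t ∈ Ioc (0 : ℝ) 1, ∫ z in B, ρ * g (x + t • z) ≤ ρ * lam * (2 * ρ) ^ n := by
    intro t ht
    have h1 : ∫ z in B, g (x + t • z) = (t ^ n)⁻¹ * ∫ z in Metric.closedBall x (t * ρ), g z := by
      rw [htrans g x, Measure.setIntegral_comp_smul_of_pos volume (fun z => g (x + z)) B ht.1]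
      simp only [Module.finrank_fin_fun, smul_eq_mul]
      rw [hB, smul_closedBall _ _ hρ.le, smul_zero, Real.norm_of_nonneg ht.1.le]
    have h2 := hx (t * ρ) (mul_pos ht.1 hρ)
    rw [integral_const_mul, h1]
    have htn : 0 < t ^ n := pow_pos ht.1 n
    calc ρ * ((t ^ n)⁻¹ * ∫ z in Metric.closedBall x (t * ρ), g z)
        ≤ ρ * ((t ^ n)⁻¹ * (lam * (2 * (t * ρ)) ^ n)) := by gcongr
      _ = ρ * ((t ^ n)⁻¹ * (lam * (t ^ n * (2 * ρ) ^ n))) := by rw [← mul_pow]; ring_nf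
      _ = _ := by field_simp
  rw [htrans]
  calc ∫ z in B, ‖φ x - φ (x + z)‖
      ≤ ∫ z in B, ∫ t in Ioc (0 : ℝ) 1, ρ * g (x + t • z) := by
        refine setIntegral_mono_on ?_ hint2.integral_prod_left measurableSet_closedBall hpt
        have : Continuous fun z => ‖φ x - φ (x + z)‖ :=
          (continuous_const.sub (hφ.continuous.comp (by fun_prop))).norm
        exact this.continuousOn.integrableOn_compact hBc
    _ = ∫ t in Ioc (0 : ℝ) 1, ∫ z in B, ρ * g (x + t • z) := integral_integral_swap hint2
    _ ≤ ∫ t in Ioc (0 : ℝ) 1, ρ * lam * (2 * ρ) ^ n := by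
        refine setIntegral_mono_on hint2.integral_prod_right
          (integrableOn_const measure_Ioc_lt_top.ne enorm_ne_top) measurableSet_Ioc hscale
    _ = _ := by simp

theorem setIntegral_norm_sub_le_of_closedBall_subset {n m : ℕ}
    {φ : (Fin n → ℝ) → (Fin m → ℝ)} (hφ : ContDiff ℝ 1 φ) {lam : ℝ} {x p : Fin n → ℝ}
    (hx : x ∈ maximalSublevel (fun y => ‖fderiv ℝ φ y‖) lam) {ρ σ : ℝ} (hρ : 0 < ρ)
    (hsub : Metric.closedBall p σ ⊆ Metric.closedBall x ρ) :
    ∫ z in Metric.closedBall p σ, ‖φ x - φ z‖ ≤ ρ * lam * (2 * ρ) ^ n := by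
  refine le_trans (setIntegral_mono_set ?_ ?_ hsub.eventuallyLE)
    (setIntegral_norm_sub_le_of_mem_maximalSublevel hφ hx hρ)
  · exact (continuous_const.sub hφ.continuous).norm.continuousOn.integrableOn_compact
      (isCompact_closedBall _ _)
  · exact ae_of_all _ fun _ => norm_nonneg _

/-! ### Lipschitz estimates and smooth approximation -/

theorem le_of_mem_maximalSublevel {n : ℕ} {g : (Fin n → ℝ) → ℝ} (hg : Continuous g) {lam : ℝ}
    {x : Fin n → ℝ} (hx : x ∈ maximalSublevel g lam) : g x ≤ lam := by
  by_contra! h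
  obtain ⟨b, hb1, hb2⟩ := exists_between h
  have h1 : ∀ᶠ y in 𝓝 x, b < g y := hg.continuousAt.eventually (lt_mem_nhds hb2)
  obtain ⟨r, hr, hsub⟩ := Metric.nhds_basis_closedBall.mem_iff.mp h1
  have h2 : b * (2 * r) ^ n ≤ ∫ z in Metric.closedBall x r, g z := by
    calc b * (2 * r) ^ n = ∫ z in Metric.closedBall x r, b := by
          rw [setIntegral_const, volume_real_closedBall_pi x hr.le, smul_eq_mul, mul_comm]
      _ ≤ _ := by
          refine setIntegral_mono_on (integrableOn_const (measure_closedBall_lt_top.ne) (by simp))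
            (hg.continuousOn.integrableOn_compact (isCompact_closedBall _ _))
            measurableSet_closedBall fun z hz => ?_
          exact le_of_lt (hsub hz)
  have h3 := hx r hr
  have h4 : 0 < (2 * r) ^ n := by positivity
  nlinarith

/-- The oscillation between two values is at most the sum of their mean distances to the values on
any ball. -/
theorem pow_mul_norm_sub_le_setIntegral_add {n m : ℕ} {φ : (Fin n → ℝ) → (Fin m → ℝ)}
    (hφ : Continuous φ) (v w p : Fin n → ℝ) {σ : ℝ} (hσ : 0 ≤ σ) :
    (2 * σ) ^ n * ‖φ v - φ w‖ ≤ (∫ z in Metric.closedBall p σ, ‖φ v - φ z‖) +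
      ∫ z in Metric.closedBall p σ, ‖φ w - φ z‖ := by
  have hi : ∀ v, IntegrableOn (fun z => ‖φ v - φ z‖) (Metric.closedBall p σ) := fun v =>
    (continuous_const.sub hφ).norm.continuousOn.integrableOn_compact (isCompact_closedBall _ _)
  rw [← integral_add (hi v) (hi w)]
  calc (2 * σ) ^ n * ‖φ v - φ w‖ = ∫ z in Metric.closedBall p σ, ‖φ v - φ w‖ := by
        rw [setIntegral_const, volume_real_closedBall_pi p hσ, smul_eq_mul]
    _ ≤ _ := by
        refine integral_mono (integrableOn_const (measure_closedBall_lt_top.ne) (by simp))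
          ((hi v).add (hi w)) fun z => ?_
        have := norm_sub_le_norm_sub_add_norm_sub (φ v) (φ z) (φ w)
        rw [norm_sub_rev (φ z)] at this
        exact this

/-- Any point outside a cube centred at the origin has nearby balls of arbitrary size outside the
cube: shift along a coordinate in which the point sticks out. -/
theorem exists_closedBall_disjoint_closedBall {n : ℕ} {s r : ℝ} (hr : 0 < r) {y : Fin n → ℝ}
    (hy : y ∉ Metric.closedBall (0 : Fin n → ℝ) s) :
    ∃ p, dist p y ≤ r / 2 ∧
      ∀ z ∈ Metric.closedBall p (r / 2), z ∉ Metric.closedBall (0 : Fin n → ℝ) s := by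
  rcases lt_or_ge s 0 with hs0 | hs0
  · refine ⟨y, by rw [dist_self]; positivity, fun z _ => ?_⟩
    rw [Metric.closedBall_eq_empty.mpr hs0]
    exact notMem_empty z
  rw [mem_closedBall_zero_iff, pi_norm_le_iff_of_nonneg hs0] at hy
  push Not at hy
  obtain ⟨i, hi⟩ := hy
  rw [Real.norm_eq_abs] at hi
  have hP : ∀ e : ℝ, |e| = r / 2 → ∃ p : Fin n → ℝ, dist p y ≤ r / 2 ∧
      ∀ z ∈ Metric.closedBall p (r / 2), |z i - (y i + e)| ≤ r / 2 := by
    intro e he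
    refine ⟨y + Pi.single i e, ?_, fun z hz => ?_⟩
    · rw [dist_eq_norm, add_sub_cancel_left, Pi.norm_single, Real.norm_eq_abs, he]
    · rw [Metric.mem_closedBall, dist_eq_norm] at hz
      have h1 := (norm_le_pi_norm (z - (y + Pi.single i e)) i).trans hz
      rwa [Pi.sub_apply, Pi.add_apply, Pi.single_eq_same, Real.norm_eq_abs] at h1
  have hout : ∀ z : Fin n → ℝ, s < |z i| → z ∉ Metric.closedBall (0 : Fin n → ℝ) s := by
    intro z h hmem
    rw [mem_closedBall_zero_iff] at hmem
    have := norm_le_pi_norm z i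
    rw [Real.norm_eq_abs] at this
    linarith
  rcases le_total 0 (y i) with h0 | h0
  · obtain ⟨p, hp, hz⟩ := hP (r / 2) (abs_of_pos (half_pos hr))
    refine ⟨p, hp, fun z hzm => hout z ?_⟩
    have h1 := (abs_le.mp (hz z hzm)).1
    rw [abs_of_nonneg h0] at hi
    have h2 : s < z i := by linarith
    exact h2.trans_le (le_abs_self _)
  · obtain ⟨p, hp, hz⟩ := hP (-(r / 2)) (by rw [abs_neg, abs_of_pos (half_pos hr)])
    refine ⟨p, hp, fun z hzm => hout z ?_⟩
    have h1 := (abs_le.mp (hz z hzm)).2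
    rw [abs_of_nonpos h0] at hi
    have h2 : s < -z i := by linarith
    exact h2.trans_le (neg_le_abs _)

/-- A `C¹` map vanishing outside a cube is Lipschitz, with constant comparable to `lam`, on the
union of `{M|Dφ| ≤ lam}` and the complement of the cube. -/
theorem lipschitzOnWith_maximalSublevel_union {n m : ℕ}
    {φ : (Fin n → ℝ) → (Fin m → ℝ)} (hφ : ContDiff ℝ 1 φ) {lam : ℝ} (hl : 0 < lam) {s : ℝ}
    (hs : ∀ x, x ∉ Metric.closedBall (0 : Fin n → ℝ) s → φ x = 0) :
    LipschitzOnWith (Real.toNNReal (3 * 4 ^ n * lam)) φ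
      (maximalSublevel (fun y => ‖fderiv ℝ φ y‖) lam ∪ (Metric.closedBall 0 s)ᶜ) := by
  have hC : 0 ≤ 3 * 4 ^ n * lam := by positivity
  -- two points of the sublevel set: compare both values with the mean over `B(x, dist x y)`
  have h1 : ∀ x ∈ maximalSublevel (fun y => ‖fderiv ℝ φ y‖) lam,
      ∀ y ∈ maximalSublevel (fun y => ‖fderiv ℝ φ y‖) lam,
      ‖φ x - φ y‖ ≤ 3 * 4 ^ n * lam * dist x y := by
    intro x hx y hy
    rcases eq_or_ne x y with rfl | hne
    · simp
    set r := dist x y with hr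
    have hr0 : 0 < r := dist_pos.mpr hne
    have e1 := setIntegral_norm_sub_le_of_mem_maximalSublevel hφ hx hr0
    have e2 := setIntegral_norm_sub_le_of_closedBall_subset (p := x) (σ := r) hφ hy
      (ρ := 2 * r) (by positivity)
      (Metric.closedBall_subset_closedBall' (by linarith))
    have e3 := pow_mul_norm_sub_le_setIntegral_add hφ.continuous x y x hr0.le
    have hV : 0 < (2 * r) ^ n := by positivity
    have e4 : (2 * (2 * r)) ^ n = 2 ^ n * (2 * r) ^ n := by rw [mul_pow]
    rw [e4] at e2
    have e5 : (2 * r) ^ n * ‖φ x - φ y‖ ≤ (2 * r) ^ n * ((1 + 2 * 2 ^ n) * lam * r) := by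
      nlinarith
    have e6 := le_of_mul_le_mul_left e5 hV
    refine e6.trans ?_
    have a1 : (1 : ℝ) ≤ 4 ^ n := one_le_pow₀ (by norm_num)
    have a2 : (2 : ℝ) ^ n ≤ 4 ^ n := pow_le_pow_left₀ (by norm_num) (by norm_num) n
    have : 1 + 2 * (2 : ℝ) ^ n ≤ 3 * 4 ^ n := by linarith
    gcongr
  -- one point outside the cube: near it there is a comparable ball on which `φ` vanishes
  have h2 : ∀ x ∈ maximalSublevel (fun y => ‖fderiv ℝ φ y‖) lam,
      ∀ y ∉ Metric.closedBall (0 : Fin n → ℝ) s,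
      ‖φ x - φ y‖ ≤ 3 * 4 ^ n * lam * dist x y := by
    intro x hx y hy
    rcases eq_or_ne x y with rfl | hne
    · simp
    set r := dist x y with hr
    have hr0 : 0 < r := dist_pos.mpr hne
    obtain ⟨p, hp, hp2⟩ := exists_closedBall_disjoint_closedBall hr0 hy
    have hp1 : dist p x ≤ 3 / 2 * r := by
      have h3 := dist_triangle p y x
      rw [dist_comm y x] at h3
      linarith
    have e2 := setIntegral_norm_sub_le_of_closedBall_subset (p := p) (σ := r / 2) hφ hx
      (ρ := 2 * r) (by positivity)
      (Metric.closedBall_subset_closedBall' (by linarith))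
    have e3 := pow_mul_norm_sub_le_setIntegral_add hφ.continuous x y p (half_pos hr0).le
    have e4 : ∫ z in Metric.closedBall p (r / 2), ‖φ y - φ z‖ = 0 := by
      rw [setIntegral_congr_fun measurableSet_closedBall (g := fun _ => (0 : ℝ))]
      · simp
      · intro z hz
        simp [hs y hy, hs z (hp2 z hz)]
    have hV : 0 < r ^ n := by positivity
    have e5 : (2 * (2 * r)) ^ n = 4 ^ n * r ^ n := by rw [← mul_pow]; ring
    have e6 : 2 * (r / 2) = r := by ring
    rw [e5] at e2
    rw [e4, e6, add_zero] at e3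
    have e7 : r ^ n * ‖φ x - φ y‖ ≤ r ^ n * (2 * 4 ^ n * lam * r) := by nlinarith
    refine (le_of_mul_le_mul_left e7 hV).trans ?_
    gcongr; norm_num
  refine LipschitzOnWith.of_dist_le_mul fun x hx y hy => ?_
  rw [Real.coe_toNNReal _ hC, dist_eq_norm]
  rcases hx with hx | hx <;> rcases hy with hy | hy
  · exact h1 x hx y hy
  · exact h2 x hx y hy
  · rw [norm_sub_rev, dist_comm]; exact h2 y hy x hx
  · rw [hs x hx, hs y hy, sub_zero, norm_zero]; positivity

theorem unitCube_eq_ball (n : ℕ) : unitCube n = Metric.ball (0 : Fin n → ℝ) (1 / 2) := by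
  rw [unitCube, ball_pi _ (by norm_num)]
  simp [Real.ball_eq_Ioo]

/-- Lipschitz maps supported strictly inside the unit cube are limits of test maps, with the same
Lipschitz constant and almost everywhere convergence of the derivatives. -/
theorem LipschitzWith.exists_isTestMap_tendsto_fderiv {n m : ℕ} {u : (Fin n → ℝ) → (Fin m → ℝ)}
    {K : NNReal} (hu : LipschitzWith K u) {s : ℝ} (hs : s < 1 / 2)
    (hsupp : ∀ x, x ∉ Metric.closedBall (0 : Fin n → ℝ) s → u x = 0) :
    ∃ ψ : ℕ → (Fin n → ℝ) → (Fin m → ℝ), (∀ k, IsTestMap (ψ k)) ∧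
      (∀ k x, ‖fderiv ℝ (ψ k) x‖ ≤ K) ∧
      ∀ᵐ x, Tendsto (fun k => fderiv ℝ (ψ k) x) atTop (𝓝 (fderiv ℝ u x)) := by
  set d : ℝ := (1 / 2 - s) / 3 with hd
  have hd0 : 0 < d := by rw [hd]; linarith
  let b : ℕ → ContDiffBump (0 : Fin n → ℝ) := fun k =>
    ⟨d / (k + 1), 2 * (d / (k + 1)), by positivity, by
      have : 0 < d / ((k : ℝ) + 1) := by positivity
      linarith⟩
  have hbout : ∀ k, (b k).rOut = 2 * (d / (k + 1)) := fun k => rfl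
  have hble : ∀ k, (b k).rOut ≤ 2 * d := by
    intro k
    rw [hbout]
    have : d / ((k : ℝ) + 1) ≤ d := div_le_self hd0.le (by
      have : (0 : ℝ) ≤ k := Nat.cast_nonneg k
      linarith)
    linarith
  have hloc : LocallyIntegrable u := hu.continuous.locallyIntegrable
  let ψ : ℕ → (Fin n → ℝ) → (Fin m → ℝ) := fun k =>
    convolution ((b k).normed volume) u (ContinuousLinearMap.lsmul ℝ ℝ) volume
  have hder : ∀ k x, HasFDerivAt (ψ k)
      (convolution ((b k).normed volume) (fderiv ℝ u) (ContinuousLinearMap.lsmul ℝ ℝ) volume x)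
      x := by
    intro k x
    have hρc : Continuous ((b k).normed (volume : Measure (Fin n → ℝ))) := (b k).continuous_normed
    have hρi : Integrable ((b k).normed (volume : Measure (Fin n → ℝ))) :=
      hρc.integrable_of_hasCompactSupport ((b k).hasCompactSupport_normed)
    have hFc : ∀ y : Fin n → ℝ, Continuous fun t : Fin n → ℝ =>
        (b k).normed volume t • u (y - t) := fun y =>
      hρc.smul (hu.continuous.comp (by fun_prop))
    refine (hasFDerivAt_integral_of_dominated_loc_of_lip (s := univ)
      (F := fun y t => (b k).normed volume t • u (y - t))
      (F' := fun t => (b k).normed volume t • fderiv ℝ u (x - t))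
      (bound := fun t => (b k).normed volume t * K) univ_mem ?_ ?_ ?_ ?_ ?_ ?_).2
    · exact Eventually.of_forall fun y => (hFc y).aestronglyMeasurable
    · exact (hFc x).integrable_of_hasCompactSupport ((b k).hasCompactSupport_normed.smul_right)
    · exact hρc.aestronglyMeasurable.smul
        ((measurable_fderiv ℝ u).comp (by fun_prop)).aestronglyMeasurable
    · refine ae_of_all _ fun t => LipschitzOnWith.of_dist_le_mul fun y _ z _ => ?_
      rw [dist_eq_norm, ← smul_sub, norm_smul, Real.coe_nnabs, abs_mul, NNReal.abs_eq,
        ← Real.norm_eq_abs, mul_assoc]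
      gcongr
      have := hu.dist_le_mul (y - t) (z - t)
      rwa [dist_eq_norm, dist_sub_right] at this
    · exact hρi.mul_const _
    · have hq := (quasiMeasurePreserving_sub_left_of_right_invariant
        (volume : Measure (Fin n → ℝ)) x).ae hu.ae_differentiableAt
      filter_upwards [hq] with t ht
      have h1 : HasFDerivAt (fun y : Fin n → ℝ => u (y - t)) (fderiv ℝ u (x - t)) x := by
        have := ht.hasFDerivAt.comp x ((hasFDerivAt_id x).sub_const t)
        simpa using! this
      exact h1.const_smul ((b k).normed volume t)
  refine ⟨ψ, fun k => ?_, fun k x => ?_, ?_⟩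
  · have hsub : Function.support (ψ k) ⊆ Metric.closedBall 0 (s + 2 * d) := by
      intro x hx
      by_contra hnot
      apply hx
      have : ∀ t, (b k).normed volume t • u (x - t) = 0 := by
        intro t
        by_cases ht : t ∈ Metric.ball (0 : Fin n → ℝ) (b k).rOut
        · rw [hsupp (x - t), smul_zero]
          intro hmem
          apply hnot
          rw [mem_closedBall_zero_iff] at hmem ⊢
          rw [mem_ball_zero_iff] at ht
          have e1 := norm_add_le (x - t) t
          rw [sub_add_cancel] at e1
          have := hble k
          linarith
        · rw [← (b k).support_normed_eq (μ := volume), Function.notMem_support] at ht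
          rw [ht, zero_smul]
      simp only [ψ, convolution, ContinuousLinearMap.lsmul_apply, this, integral_zero]
    have hts : tsupport (ψ k) ⊆ Metric.closedBall 0 (s + 2 * d) :=
      closure_minimal hsub Metric.isClosed_closedBall
    refine ⟨?_, ?_, ?_⟩
    · exact ((b k).hasCompactSupport_normed).contDiff_convolution_left _ (b k).contDiff_normed hloc
    · exact (isCompact_closedBall _ _).of_isClosed_subset (isClosed_tsupport _) hts
    · rw [unitCube_eq_ball]
      exact hts.trans (Metric.closedBall_subset_ball (by rw [hd]; linarith))
  · rw [(hder k x).fderiv]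
    calc _ ≤ ∫ t, (b k).normed volume t * K := by
          refine norm_integral_le_of_norm_le ?_ (ae_of_all _ fun t => ?_)
          · exact (((b k).continuous_normed).integrable_of_hasCompactSupport
              ((b k).hasCompactSupport_normed)).mul_const _
          · rw [ContinuousLinearMap.lsmul_apply, norm_smul,
              Real.norm_of_nonneg ((b k).nonneg_normed _)]
            gcongr
            · exact (b k).nonneg_normed _
            · exact norm_fderiv_le_of_lipschitz ℝ hu
      _ = K := by rw [integral_mul_const, (b k).integral_normed, one_mul]
  · have hli : LocallyIntegrable (fderiv ℝ u) volume := by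
      refine (locallyIntegrable_const (K : ℝ)).mono
        (measurable_fderiv ℝ u).aestronglyMeasurable (ae_of_all _ fun x => ?_)
      exact (norm_fderiv_le_of_lipschitz ℝ hu).trans (le_abs_self _)
    have := ContDiffBump.ae_convolution_tendsto_right_of_locallyIntegrable (φ := b) (l := atTop)
      (K := 2) ?_ (Eventually.of_forall fun k => le_rfl) hli
    · filter_upwards [this] with x hx
      simpa only [(hder _ x).fderiv] using hx
    · have h1 : Tendsto (fun k : ℕ => 2 * (d * (1 / ((k : ℝ) + 1)))) atTop (𝓝 (2 * (d * 0))) :=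
        (tendsto_one_div_add_atTop_nhds_zero_nat.const_mul d).const_mul 2
      simpa [hbout, div_eq_mul_inv] using h1

/-! ### Lipschitz truncation -/

/-- Two maps that agree on a measurable set have the same derivative at almost every point of it. -/
theorem ae_fderiv_eq_of_eqOn {n m : ℕ} {u v : (Fin n → ℝ) → (Fin m → ℝ)}
    (hu : ∀ᵐ x, DifferentiableAt ℝ u x) (hv : Differentiable ℝ v) {S : Set (Fin n → ℝ)}
    (hS : MeasurableSet S) (h : EqOn u v S) : ∀ᵐ x, x ∈ S → fderiv ℝ u x = fderiv ℝ v x := by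
  set T := S ∩ {x | DifferentiableAt ℝ u x} with hT
  have hTm : MeasurableSet T := hS.inter (measurableSet_of_differentiableAt ℝ u)
  let ι : ℝ →L[ℝ] (Fin n → ℝ) := ContinuousLinearMap.pi fun _ => ContinuousLinearMap.id ℝ ℝ
  have hcomp : ∀ i : Fin m, ∀ᵐ x, x ∈ T → ∀ w, (fderiv ℝ u x - fderiv ℝ v x) w i = 0 := by
    intro i
    let P : (Fin m → ℝ) →L[ℝ] (Fin n → ℝ) := ι.comp (ContinuousLinearMap.proj i)
    -- the scalar difference is copied into all coordinates to become a self-map of `ℝⁿ`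
    have hlin : ApproximatesLinearOn (fun x => P (u x - v x)) (0 : (Fin n → ℝ) →L[ℝ] (Fin n → ℝ))
        T 0 := by
      intro x hx y hy
      simp [h hx.1, h hy.1]
    have := hlin.norm_fderiv_sub_le volume hTm
      (fun x => P.comp (fderiv ℝ u x - fderiv ℝ v x)) fun x hx =>
        (P.hasFDerivAt.comp x (hx.2.hasFDerivAt.sub (hv x).hasFDerivAt)).hasFDerivWithinAt
    rw [ae_restrict_iff' hTm] at this
    filter_upwards [this] with x hx hxT w
    have h0 : P.comp (fderiv ℝ u x - fderiv ℝ v x) = 0 := by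
      have := hx hxT
      simpa using this
    rcases Nat.eq_zero_or_pos n with rfl | hn
    · rw [Subsingleton.elim w 0, map_zero, Pi.zero_apply]
    · have := congrFun (DFunLike.congr_fun h0 w) ⟨0, hn⟩
      simpa [P, ι] using this
  filter_upwards [ae_all_iff.mpr hcomp, hu] with x hx hxd hxS
  rw [← sub_eq_zero]
  ext w i
  exact hx i ⟨hxS, hxd⟩ w

theorem fderiv_eq_zero_of_notMem_unitCube {n m : ℕ} {φ : (Fin n → ℝ) → (Fin m → ℝ)}
    (hφ : IsTestMap φ) {x : Fin n → ℝ} (hx : x ∉ unitCube n) : fderiv ℝ φ x = 0 :=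
  image_eq_zero_of_notMem_tsupport fun h =>
    hx (hφ.tsupport_subset (tsupport_fderiv_subset ℝ h))

theorem IsTestMap.continuous_fderiv {n m : ℕ} {φ : (Fin n → ℝ) → (Fin m → ℝ)}
    (hφ : IsTestMap φ) : Continuous (fderiv ℝ φ) :=
  hφ.contDiff.continuous_fderiv (by simp)

/-- **Lipschitz truncation.** A test map can be replaced by test maps with gradients of size at most
a multiple of `lam`, changing the gradient, in the limit, only on a set `U` whose measure is
controlled by the part of `|Dφ|` above `lam / 2`. -/
theorem IsTestMap.exists_lipschitz_truncation {n m : ℕ} {φ : (Fin n → ℝ) → (Fin m → ℝ)}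
    (hφ : IsTestMap φ) {lam : ℝ} (hl : 0 < lam) :
    ∃ U : Set (Fin n → ℝ), MeasurableSet U ∧
      volume U ≤ ENNReal.ofReal
        (4 ^ n * (2 / lam * ∫ x in unitCube n, max (‖fderiv ℝ φ x‖ - lam / 2) 0)) ∧
      (∀ x ∉ U, ‖fderiv ℝ φ x‖ ≤ lam) ∧
      ∃ ψ : ℕ → (Fin n → ℝ) → (Fin m → ℝ), (∀ k, IsTestMap (ψ k)) ∧
        (∀ k x, ‖fderiv ℝ (ψ k) x‖ ≤ 3 * 4 ^ n * lam) ∧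
        ∀ᵐ x, x ∉ U → Tendsto (fun k => fderiv ℝ (ψ k) x) atTop (𝓝 (fderiv ℝ φ x)) := by
  have hC : 0 ≤ 3 * 4 ^ n * lam := by positivity
  rcases Nat.eq_zero_or_pos n with rfl | hn
  · have h0 : ∀ x, fderiv ℝ φ x = 0 := fun x => by
      ext w i
      rw [Subsingleton.elim w 0, map_zero, map_zero]
    refine ⟨∅, MeasurableSet.empty, by simp, fun x _ => by simp [h0 x, hl.le], fun _ => φ,
      fun _ => hφ, fun k x => by rw [h0 x, norm_zero]; exact hC,
      ae_of_all _ fun x _ => tendsto_const_nhds⟩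
  set g : (Fin n → ℝ) → ℝ := fun x => ‖fderiv ℝ φ x‖ with hg
  have hgc : Continuous g := hφ.continuous_fderiv.norm
  have hgs : HasCompactSupport g := (hφ.hasCompactSupport.fderiv ℝ).norm
  have hfi : Integrable fun x => max (g x - lam / 2) 0 := by
    refine Continuous.integrable_of_hasCompactSupport (by fun_prop) ?_
    refine hgs.comp_left (g := fun t : ℝ => max (t - lam / 2) 0) ?_
    rw [max_eq_right]; linarith
  obtain ⟨U, hUm, hU, hvol⟩ := exists_measurable_superset_compl_maximalSublevel hn
    (hgc.integrable_of_hasCompactSupport hgs) hl hfi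
  have hcompl : ∀ x ∉ U, x ∈ maximalSublevel g lam := fun x hx => by
    by_contra h
    exact hx (hU h)
  have hzero : ∀ x ∉ unitCube n, max (g x - lam / 2) 0 = 0 := by
    intro x hx
    rw [hg]
    simp only [fderiv_eq_zero_of_notMem_unitCube hφ hx, norm_zero]
    rw [max_eq_right]; linarith
  have hts : tsupport φ ⊆ Metric.ball 0 (1 / 2) := by
    rw [← unitCube_eq_ball]; exact hφ.tsupport_subset
  obtain ⟨s, hs, hsub⟩ := exists_lt_subset_ball (isClosed_tsupport φ) hts
  have hout : ∀ x, x ∉ Metric.closedBall (0 : Fin n → ℝ) s → φ x = 0 := fun x hx =>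
    image_eq_zero_of_notMem_tsupport fun h => hx (Metric.ball_subset_closedBall (hsub h))
  have hφ1 : ContDiff ℝ 1 φ := hφ.contDiff.of_le (by simp)
  obtain ⟨u, hu, hueq⟩ := (lipschitzOnWith_maximalSublevel_union hφ1 hl hout).extend_pi
  obtain ⟨ψ, hψ, hψb, hψt⟩ := hu.exists_isTestMap_tendsto_fderiv hs fun x hx => by
    rw [← hueq (Or.inr hx)]; exact hout x hx
  refine ⟨U, hUm, ?_, fun x hx => le_of_mem_maximalSublevel hgc (hcompl x hx), ψ, hψ, ?_, ?_⟩
  · rwa [setIntegral_eq_integral_of_forall_compl_eq_zero hzero]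
  · intro k x
    have := hψb k x
    rwa [Real.coe_toNNReal _ hC] at this
  · have hae := ae_fderiv_eq_of_eqOn hu.ae_differentiableAt
      (hφ1.differentiable one_ne_zero) hUm.compl
      (fun x hx => (hueq (Or.inl (hcompl x hx))).symm)
    filter_upwards [hψt, hae] with x h1 h2 hx
    rw [← h2 hx]
    exact h1

/-! ### Test maps, rescaling and Dacorogna's formula -/

theorem IsTestMap.of_eq_zero {n m : ℕ} {φ : (Fin n → ℝ) → (Fin m → ℝ)} (h : ContDiff ℝ ∞ φ)
    {K : Set (Fin n → ℝ)} (hK : IsCompact K) (hsub : K ⊆ unitCube n) (h0 : ∀ x ∉ K, φ x = 0) :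
    IsTestMap φ := by
  have hs : tsupport φ ⊆ K := closure_minimal (fun x hx => by
    by_contra hn
    exact hx (h0 x hn)) hK.isClosed
  exact ⟨h, hK.of_isClosed_subset (isClosed_tsupport _) hs, hs.trans hsub⟩

theorem isTestMap_zero {n m : ℕ} : IsTestMap (fun _ : Fin n → ℝ => (0 : Fin m → ℝ)) :=
  .of_eq_zero contDiff_const isCompact_empty (empty_subset _) fun _ _ => rfl

theorem IsTestMap.add {n m : ℕ} {φ ψ : (Fin n → ℝ) → (Fin m → ℝ)} (hφ : IsTestMap φ)
    (hψ : IsTestMap ψ) : IsTestMap (fun x => φ x + ψ x) := by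
  refine .of_eq_zero (hφ.contDiff.add hψ.contDiff)
    (hφ.hasCompactSupport.isCompact.union hψ.hasCompactSupport.isCompact)
    (union_subset hφ.tsupport_subset hψ.tsupport_subset) fun x hx => ?_
  rw [mem_union, not_or] at hx
  rw [image_eq_zero_of_notMem_tsupport hx.1, image_eq_zero_of_notMem_tsupport hx.2, add_zero]

theorem IsTestMap.sum {n m : ℕ} {ι : Type*} (s : Finset ι) {φ : ι → (Fin n → ℝ) → (Fin m → ℝ)}
    (h : ∀ i ∈ s, IsTestMap (φ i)) : IsTestMap (fun x => ∑ i ∈ s, φ i x) := by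
  classical
  induction s using Finset.induction_on with
  | empty => simpa using! isTestMap_zero
  | insert a s ha ih =>
    simp only [Finset.sum_insert ha]
    exact (h a (Finset.mem_insert_self _ _)).add
      (ih fun i hi => h i (Finset.mem_insert_of_mem hi))

theorem IsTestMap.differentiable {n m : ℕ} {φ : (Fin n → ℝ) → (Fin m → ℝ)} (hφ : IsTestMap φ) :
    Differentiable ℝ φ := hφ.contDiff.differentiable (by simp)

/-- The copy of `φ` living on the sup-norm ball `B(a, r)`, a cube of side `2 r`, scaled so that its
gradient takes the same values as that of `φ`. -/
noncomputable def rescale {n m : ℕ} (φ : (Fin n → ℝ) → (Fin m → ℝ)) (a : Fin n → ℝ) (r : ℝ)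
    (x : Fin n → ℝ) : Fin m → ℝ :=
  (2 * r) • φ ((2 * r)⁻¹ • (x - a))

theorem smul_sub_mem_unitCube_iff {n : ℕ} {a x : Fin n → ℝ} {r : ℝ} (hr : 0 < r) :
    (2 * r)⁻¹ • (x - a) ∈ unitCube n ↔ x ∈ Metric.ball a r := by
  rw [unitCube_eq_ball, mem_ball_zero_iff, norm_smul, Real.norm_of_nonneg (by positivity),
    Metric.mem_ball, dist_eq_norm, inv_mul_lt_iff₀ (by positivity)]
  ring_nf

theorem IsTestMap.rescale {n m : ℕ} {φ : (Fin n → ℝ) → (Fin m → ℝ)} (hφ : IsTestMap φ)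
    {a : Fin n → ℝ} {r : ℝ} (hr : 0 < r) (hsub : Metric.ball a r ⊆ unitCube n) :
    IsTestMap (rescale φ a r) := by
  have h2 : (2 * r) ≠ 0 := by positivity
  refine .of_eq_zero (K := (fun y => a + (2 * r) • y) '' tsupport φ) ?_ ?_ ?_ fun x hx => ?_
  · have := hφ.contDiff
    unfold _root_.rescale
    fun_prop
  · exact hφ.hasCompactSupport.isCompact.image (by fun_prop)
  · rintro _ ⟨y, hy, rfl⟩
    apply hsub
    rw [← smul_sub_mem_unitCube_iff hr, add_sub_cancel_left, inv_smul_smul₀ h2]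
    exact hφ.tsupport_subset hy
  · rw [_root_.rescale, image_eq_zero_of_notMem_tsupport (f := φ), smul_zero]
    intro h
    exact hx ⟨_, h, by simp only [smul_inv_smul₀ h2, add_sub_cancel]⟩

theorem gradMatrix_rescale {n m : ℕ} {φ : (Fin n → ℝ) → (Fin m → ℝ)} (hφ : IsTestMap φ)
    (a : Fin n → ℝ) {r : ℝ} (hr : 0 < r) (x : Fin n → ℝ) :
    gradMatrix (rescale φ a r) x = gradMatrix φ ((2 * r)⁻¹ • (x - a)) := by
  have h2 : (2 * r) ≠ 0 := by positivity
  have h1 : HasFDerivAt (rescale φ a r) (fderiv ℝ φ ((2 * r)⁻¹ • (x - a))) x := by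
    have e1 : HasFDerivAt (fun x : Fin n → ℝ => (2 * r)⁻¹ • (x - a))
        ((2 * r)⁻¹ • ContinuousLinearMap.id ℝ (Fin n → ℝ)) x :=
      ((hasFDerivAt_id x).sub_const a).const_smul (2 * r)⁻¹
    have e2 := ((hφ.differentiable _).hasFDerivAt.comp x e1).const_smul (2 * r)
    have e3 : (2 * r) • (fderiv ℝ φ ((2 * r)⁻¹ • (x - a))).comp
        ((2 * r)⁻¹ • ContinuousLinearMap.id ℝ (Fin n → ℝ))
        = fderiv ℝ φ ((2 * r)⁻¹ • (x - a)) := by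
      ext w i
      simp only [_root_.smul_apply, ContinuousLinearMap.comp_apply,
        ContinuousLinearMap.id_apply, map_smul, smul_inv_smul₀ h2]
    rw [e3] at e2
    exact e2
  rw [gradMatrix, h1.fderiv, gradMatrix]

theorem gradMatrix_add {n m : ℕ} {φ ψ : (Fin n → ℝ) → (Fin m → ℝ)} (hφ : Differentiable ℝ φ)
    (hψ : Differentiable ℝ ψ) (x : Fin n → ℝ) :
    gradMatrix (fun x => φ x + ψ x) x = gradMatrix φ x + gradMatrix ψ x := by
  ext i j
  simp [gradMatrix, fderiv_fun_add (hφ x) (hψ x)]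

theorem gradMatrix_sum {n m : ℕ} {ι : Type*} (s : Finset ι)
    {φ : ι → (Fin n → ℝ) → (Fin m → ℝ)} (h : ∀ i ∈ s, Differentiable ℝ (φ i)) (x : Fin n → ℝ) :
    gradMatrix (fun x => ∑ i ∈ s, φ i x) x = ∑ i ∈ s, gradMatrix (φ i) x := by
  ext i j
  rw [Matrix.sum_apply]
  simp [gradMatrix, fderiv_fun_sum fun i hi => h i hi x]

theorem gradMatrix_eq_zero_of_notMem_unitCube {n m : ℕ} {φ : (Fin n → ℝ) → (Fin m → ℝ)}
    (hφ : IsTestMap φ) {x : Fin n → ℝ} (hx : x ∉ unitCube n) : gradMatrix φ x = 0 := by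
  ext i j
  simp [gradMatrix, fderiv_eq_zero_of_notMem_unitCube hφ hx]

theorem IsTestMap.continuous_gradMatrix {n m : ℕ} {φ : (Fin n → ℝ) → (Fin m → ℝ)}
    (hφ : IsTestMap φ) : Continuous (gradMatrix φ) := by
  have := hφ.continuous_fderiv
  unfold gradMatrix
  exact continuous_matrix fun i j => by simp only [Matrix.of_apply]; fun_prop

theorem volume_unitCube (n : ℕ) : volume (unitCube n) = 1 := by
  rw [unitCube_eq_ball, Real.volume_pi_ball _ (by norm_num)]
  norm_num

theorem measurableSet_unitCube (n : ℕ) : MeasurableSet (unitCube n) := by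
  rw [unitCube_eq_ball]; exact measurableSet_ball

theorem unitCube_subset_closedBall (n : ℕ) :
    unitCube n ⊆ Metric.closedBall (0 : Fin n → ℝ) (1 / 2) := by
  rw [unitCube_eq_ball]; exact Metric.ball_subset_closedBall

theorem unitCube_ae_eq (n : ℕ) :
    unitCube n =ᵐ[volume] Metric.closedBall (0 : Fin n → ℝ) (1 / 2) := by
  refine ae_eq_of_subset_of_measure_ge (unitCube_subset_closedBall n) ?_
    (measurableSet_unitCube n).nullMeasurableSet measure_closedBall_lt_top.ne
  rw [volume_unitCube, Real.volume_pi_closedBall _ (by norm_num)]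
  norm_num

theorem Continuous.integrableOn_unitCube {n : ℕ} {f : (Fin n → ℝ) → ℝ} (hf : Continuous f) :
    IntegrableOn f (unitCube n) :=
  (hf.continuousOn.integrableOn_compact (isCompact_closedBall _ _)).mono_set
    (unitCube_subset_closedBall n)

theorem setIntegral_closedBall_eq_mul {n : ℕ} (F : (Fin n → ℝ) → ℝ) (a : Fin n → ℝ) {r : ℝ}
    (hr : 0 < r) :
    ∫ z in Metric.closedBall a r, F z =
      (2 * r) ^ n * ∫ z in Metric.closedBall (0 : Fin n → ℝ) (1 / 2), F (a + (2 * r) • z) := by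
  have h2 : 0 < 2 * r := by positivity
  have h1 := (measurePreserving_add_left (volume : Measure (Fin n → ℝ)) a).setIntegral_preimage_emb
    (measurableEmbedding_addLeft a) F (Metric.closedBall a r)
  have h3 : (fun x => a + x) ⁻¹' Metric.closedBall a r = Metric.closedBall 0 r := by
    ext z; simp [dist_eq_norm]
  rw [h3] at h1
  rw [← h1, Measure.setIntegral_comp_smul_of_pos volume (fun z => F (a + z)) _ h2]
  simp only [Module.finrank_fin_fun, smul_eq_mul]
  rw [smul_closedBall _ _ (by norm_num), smul_zero, Real.norm_of_nonneg h2.le,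
    mul_inv_cancel_left₀ (by positivity)]
  congr 3
  ring

/-- Dacorogna's formula: the infimum of the energies `∫ h(ξ + ∇φ)` over test maps. -/
noncomputable def testEnvelope {m n : ℕ} (h : Matrix (Fin m) (Fin n) ℝ → ℝ)
    (ξ : Matrix (Fin m) (Fin n) ℝ) : ℝ :=
  ⨅ φ : {φ : (Fin n → ℝ) → (Fin m → ℝ) // IsTestMap φ},
    ∫ x in unitCube n, h (ξ + gradMatrix φ.1 x)

section testEnvelope

variable {m n : ℕ} {h : Matrix (Fin m) (Fin n) ℝ → ℝ}

theorem bddBelow_energy (h0 : ∀ η, 0 ≤ h η) (ξ : Matrix (Fin m) (Fin n) ℝ) :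
    BddBelow (range fun φ : {φ : (Fin n → ℝ) → (Fin m → ℝ) // IsTestMap φ} =>
      ∫ x in unitCube n, h (ξ + gradMatrix φ.1 x)) :=
  ⟨0, by rintro _ ⟨φ, rfl⟩; exact integral_nonneg fun x => h0 _⟩

theorem testEnvelope_nonneg (h0 : ∀ η, 0 ≤ h η) (ξ : Matrix (Fin m) (Fin n) ℝ) :
    0 ≤ testEnvelope h ξ :=
  Real.iInf_nonneg fun _ => integral_nonneg fun _ => h0 _

theorem testEnvelope_le_integral (h0 : ∀ η, 0 ≤ h η) (ξ : Matrix (Fin m) (Fin n) ℝ)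
    {φ : (Fin n → ℝ) → (Fin m → ℝ)} (hφ : IsTestMap φ) :
    testEnvelope h ξ ≤ ∫ x in unitCube n, h (ξ + gradMatrix φ x) :=
  ciInf_le (bddBelow_energy h0 ξ) ⟨φ, hφ⟩

theorem exists_integral_lt_testEnvelope_add (h : Matrix (Fin m) (Fin n) ℝ → ℝ)
    (ξ : Matrix (Fin m) (Fin n) ℝ) {ε : ℝ} (hε : 0 < ε) :
    ∃ φ : (Fin n → ℝ) → (Fin m → ℝ), IsTestMap φ ∧
      ∫ x in unitCube n, h (ξ + gradMatrix φ x) < testEnvelope h ξ + ε := by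
  have : Nonempty {φ : (Fin n → ℝ) → (Fin m → ℝ) // IsTestMap φ} := ⟨⟨_, isTestMap_zero⟩⟩
  obtain ⟨φ, hφ⟩ := exists_lt_of_ciInf_lt
    (show testEnvelope h ξ < testEnvelope h ξ + ε by linarith)
  exact ⟨φ.1, φ.2, hφ⟩

theorem testEnvelope_le (h0 : ∀ η, 0 ≤ h η) (ξ : Matrix (Fin m) (Fin n) ℝ) :
    testEnvelope h ξ ≤ h ξ := by
  refine (testEnvelope_le_integral h0 ξ isTestMap_zero).trans_eq ?_
  have : ∀ x : Fin n → ℝ, gradMatrix (fun _ : Fin n → ℝ => (0 : Fin m → ℝ)) x = 0 := by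
    intro x; ext i j; simp [gradMatrix]
  simp [this, Measure.real, volume_unitCube]

instance : LocallyCompactSpace (Matrix (Fin m) (Fin n) ℝ) :=
  inferInstanceAs (LocallyCompactSpace (Fin m → Fin n → ℝ))

instance : FirstCountableTopology (Matrix (Fin m) (Fin n) ℝ) :=
  inferInstanceAs (FirstCountableTopology (Fin m → Fin n → ℝ))

theorem upperSemicontinuous_testEnvelope (hc : Continuous h) (h0 : ∀ η, 0 ≤ h η) :
    UpperSemicontinuous (testEnvelope h) := by
  refine upperSemicontinuous_ciInf (fun ξ => bddBelow_energy h0 ξ) fun φ => ?_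
  refine Continuous.upperSemicontinuous ?_
  simp only [setIntegral_congr_set (unitCube_ae_eq n)]
  refine continuous_parametric_integral_of_continuous ?_ (isCompact_closedBall _ _)
  exact hc.comp (continuous_fst.add (φ.2.continuous_gradMatrix.comp continuous_snd))

end testEnvelope

/-! ### Quasiconvexity of Dacorogna's formula -/

section testEnvelope

variable {m n : ℕ} {h : Matrix (Fin m) (Fin n) ℝ → ℝ}

/-- At scale `r → 0` a rescaled competitor `ψ` placed at `a` has, per unit volume, the energy it has
on top of the constant gradient `ξ + ∇φ(a)`. -/
theorem tendsto_energy_rescale (hc : Continuous h) (ξ : Matrix (Fin m) (Fin n) ℝ)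
    {φ ψ : (Fin n → ℝ) → (Fin m → ℝ)} (hφ : IsTestMap φ) (hψ : IsTestMap ψ) (a : Fin n → ℝ) :
    Tendsto (fun r : ℝ => ((2 * r) ^ n)⁻¹ *
        ∫ x in Metric.closedBall a r, h (ξ + gradMatrix φ x + gradMatrix (rescale ψ a r) x))
      (𝓝[>] 0) (𝓝 (∫ x in unitCube n, h (ξ + gradMatrix φ a + gradMatrix ψ x))) := by
  have hcont : Continuous fun r : ℝ => ∫ z in Metric.closedBall (0 : Fin n → ℝ) (1 / 2),
      h (ξ + gradMatrix φ (a + (2 * r) • z) + gradMatrix ψ z) := by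
    refine continuous_parametric_integral_of_continuous ?_ (isCompact_closedBall _ _)
    refine hc.comp ((continuous_const.add (hφ.continuous_gradMatrix.comp ?_)).add
      (hψ.continuous_gradMatrix.comp continuous_snd))
    fun_prop
  have h1 := (hcont.tendsto 0).mono_left (nhdsWithin_le_nhds (s := Ioi 0))
  simp only [mul_zero, zero_smul, add_zero] at h1
  rw [setIntegral_congr_set (unitCube_ae_eq n)]
  refine h1.congr' ?_
  filter_upwards [self_mem_nhdsWithin] with r hr
  have hr0 : 0 < r := hr
  have h2 : 2 * r ≠ 0 := by positivity
  rw [setIntegral_closedBall_eq_mul _ a hr0, inv_mul_cancel_left₀ (by positivity)]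
  simp only [gradMatrix_rescale hψ a hr0, add_sub_cancel_left, inv_smul_smul₀ h2]

/-- From the balls of a countable disjoint family that covers almost all of the cube, finitely many
cover it up to a set of small measure. -/
theorem exists_finset_volume_diff_le {t : Set (Fin n → ℝ)} (ht : t.Countable)
    {B : (Fin n → ℝ) → Set (Fin n → ℝ)} (hBm : ∀ x, MeasurableSet (B x))
    (hBs : ∀ x ∈ t, B x ⊆ unitCube n) (hd : t.PairwiseDisjoint B)
    (hcov : volume (unitCube n \ ⋃ x ∈ t, B x) = 0) {ε : ℝ} (hε : 0 < ε) :
    ∃ F : Finset (Fin n → ℝ), ↑F ⊆ t ∧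
      volume (unitCube n \ ⋃ x ∈ F, B x) ≤ ENNReal.ofReal ε := by
  classical
  have : Countable t := ht.to_subtype
  have hsum : ∑' x : t, volume (B x) ≠ ⊤ := by
    rw [← measure_biUnion ht hd fun x _ => hBm x]
    refine ne_top_of_le_ne_top ?_ (measure_mono (iUnion₂_subset hBs))
    rw [volume_unitCube]; exact ENNReal.one_ne_top
  have hlim := ENNReal.tendsto_tsum_compl_atTop_zero hsum
  obtain ⟨F, hF⟩ := (hlim.eventually_le_const (ENNReal.ofReal_pos.mpr hε)).exists
  refine ⟨F.map (Function.Embedding.subtype _), by intro x; simp; tauto, ?_⟩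
  calc volume (unitCube n \ ⋃ x ∈ F.map (Function.Embedding.subtype _), B x)
      ≤ volume ((unitCube n \ ⋃ x ∈ t, B x) ∪ ⋃ x : {x : t // x ∉ F}, B x) := by
        refine measure_mono fun y hy => ?_
        by_cases hyt : y ∈ ⋃ x ∈ t, B x
        · right
          obtain ⟨x, hx, hyx⟩ := mem_iUnion₂.mp hyt
          refine mem_iUnion.mpr ⟨⟨⟨x, hx⟩, fun hxF => hy.2 ?_⟩, hyx⟩
          exact mem_iUnion₂.mpr ⟨x, Finset.mem_map.mpr ⟨⟨x, hx⟩, hxF, rfl⟩, hyx⟩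
        · exact Or.inl ⟨hy.1, hyt⟩
    _ ≤ volume (unitCube n \ ⋃ x ∈ t, B x) + volume (⋃ x : {x : t // x ∉ F}, B x) :=
        measure_union_le _ _
    _ ≤ 0 + ∑' x : {x : t // x ∉ F}, volume (B x) := by
        rw [hcov]
        gcongr
        exact measure_iUnion_le _
    _ ≤ _ := by rw [zero_add]; exact hF

theorem measurable_testEnvelope_comp (hc : Continuous h) (h0 : ∀ η, 0 ≤ h η)
    {G : (Fin n → ℝ) → Matrix (Fin m) (Fin n) ℝ} (hG : Continuous G) :
    Measurable fun x => testEnvelope h (G x) :=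
  measurable_of_Iio fun y =>
    (((upperSemicontinuous_testEnvelope hc h0).isOpen_preimage y).preimage hG).measurableSet

/-- The quasiconvexity inequality for `testEnvelope h`. Almost all of the cube is covered by
disjoint small cubes on which `∇φ` is nearly constant and `testEnvelope h (ξ + ∇φ)` is close to its
mean; adding to `φ` a rescaled nearly optimal competitor on finitely many of them produces a
competitor for `testEnvelope h ξ`. -/
theorem testEnvelope_le_integral_testEnvelope (hc : Continuous h) (h0 : ∀ η, 0 ≤ h η)
    (ξ : Matrix (Fin m) (Fin n) ℝ) {φ : (Fin n → ℝ) → (Fin m → ℝ)} (hφ : IsTestMap φ) :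
    testEnvelope h ξ ≤ ∫ x in unitCube n, testEnvelope h (ξ + gradMatrix φ x) := by
  classical
  set H : (Fin n → ℝ) → ℝ := fun x => testEnvelope h (ξ + gradMatrix φ x) with hH
  have hGc : Continuous fun x => ξ + gradMatrix φ x :=
    continuous_const.add hφ.continuous_gradMatrix
  have hHm : Measurable H := measurable_testEnvelope_comp hc h0 hGc
  have hH0 : ∀ x, 0 ≤ H x := fun x => testEnvelope_nonneg h0 _
  have hhc : Continuous fun x => h (ξ + gradMatrix φ x) := hc.comp hGc
  have hHl : LocallyIntegrable H := by
    refine hhc.locallyIntegrable.mono hHm.aestronglyMeasurable (ae_of_all _ fun x => ?_)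
    rw [Real.norm_of_nonneg (hH0 x), Real.norm_of_nonneg (h0 _)]
    exact testEnvelope_le h0 _
  have hHQ : IntegrableOn H (unitCube n) :=
    (hHl.integrableOn_isCompact (isCompact_closedBall _ _)).mono_set (unitCube_subset_closedBall n)
  obtain ⟨M, hM⟩ := (isCompact_closedBall (0 : Fin n → ℝ) (1 / 2)).bddAbove_image hhc.continuousOn
  have hM' : ∀ x ∈ unitCube n, h (ξ + gradMatrix φ x) ≤ max M 0 := fun x hx =>
    (hM ⟨x, unitCube_subset_closedBall n hx, rfl⟩).trans (le_max_left _ _)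
  -- `M' ε` bounds the energy on the part of the cube left uncovered, of measure `≤ ε`
  set M' := max M 0 with hM'def
  have hM0 : 0 ≤ M' := le_max_right _ _
  refine le_of_forall_pos_le_add fun ε' hε' => ?_
  set ε := ε' / (3 + M') with hεdef
  have hε : 0 < ε := by positivity
  choose ψ hψ hψlt using fun x => exists_integral_lt_testEnvelope_add h (ξ + gradMatrix φ x) hε
  -- the Lebesgue points of `H`
  set S := {x ∈ unitCube n | Tendsto (fun r : ℝ => ⨍ y in Metric.closedBall x r, H y) (𝓝[>] 0)
    (𝓝 (H x))} with hS
  have hSae : volume (unitCube n \ S) = 0 := by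
    have := IsUnifLocDoublingMeasure.ae_tendsto_average volume hHl 1
    refine measure_mono_null (fun x hx => ?_) (ae_iff.mp this)
    intro hcon
    refine hx.2 ⟨hx.1, hcon (fun _ => x) id tendsto_id ?_⟩
    filter_upwards [self_mem_nhdsWithin] with r hr
    exact Metric.mem_closedBall_self (by simpa using (le_of_lt hr : (0 : ℝ) ≤ r))
  have hRex : ∀ x : Fin n → ℝ, ∃ R : ℝ, 0 < R ∧
      (x ∈ unitCube n → Metric.ball x R ⊆ unitCube n) := by
    intro x
    by_cases hx : x ∈ unitCube n
    · have ho : IsOpen (unitCube n) := by rw [unitCube_eq_ball]; exact Metric.isOpen_ball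
      obtain ⟨R, hR, hsub⟩ := Metric.isOpen_iff.mp ho x hx
      exact ⟨R, hR, fun _ => hsub⟩
    · exact ⟨1, one_pos, fun h => absurd h hx⟩
  choose R hR0 hRsub using hRex
  -- the admissible radii at `x`, at which the rescaled competitor is nearly optimal
  let P : (Fin n → ℝ) → Set ℝ := fun x =>
    {r | ∫ y in Metric.closedBall x r, h (ξ + gradMatrix φ y + gradMatrix (rescale (ψ x) x r) y)
      ≤ (∫ y in Metric.closedBall x r, H y) + 3 * ε * (2 * r) ^ n}
  have hmemP : ∀ x r, r ∈ P x ↔ ∫ y in Metric.closedBall x r,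
      h (ξ + gradMatrix φ y + gradMatrix (rescale (ψ x) x r) y)
        ≤ (∫ y in Metric.closedBall x r, H y) + 3 * ε * (2 * r) ^ n := fun _ _ => Iff.rfl
  have hP : ∀ x ∈ S, ∀ δ > 0, (P x ∩ Ioo 0 δ).Nonempty := by
    intro x hx δ hδ
    have e1 : ∀ᶠ r : ℝ in 𝓝[>] 0, ((2 * r) ^ n)⁻¹ * ∫ y in Metric.closedBall x r,
        h (ξ + gradMatrix φ y + gradMatrix (rescale (ψ x) x r) y) < H x + ε :=
      (tendsto_energy_rescale hc ξ hφ (hψ x) x).eventually_lt_const (hψlt x)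
    have e2 : ∀ᶠ r : ℝ in 𝓝[>] 0, H x - ε < ⨍ y in Metric.closedBall x r, H y :=
      hx.2.eventually_const_lt (by linarith)
    have e3 : ∀ᶠ r : ℝ in 𝓝[>] 0, r ∈ Ioo 0 δ := Ioo_mem_nhdsGT hδ
    obtain ⟨r, h1, h2, h3⟩ := (e1.and (e2.and e3)).exists
    refine ⟨r, ?_, h3⟩
    have hV : 0 < (2 * r) ^ n := by have := h3.1; positivity
    rw [setAverage_eq, volume_real_closedBall_pi x h3.1.le, smul_eq_mul] at h2
    rw [inv_mul_lt_iff₀ hV] at h1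
    rw [lt_inv_mul_iff₀ hV] at h2
    rw [hmemP]
    nlinarith [mul_pos hε hV]
  obtain ⟨t, r, htc, htS, htr, htcov, htd⟩ := Besicovitch.exists_disjoint_closedBall_covering_ae
    volume P S hP R fun x _ => hR0 x
  have hBsub : ∀ x ∈ t, Metric.closedBall x (r x) ⊆ unitCube n := fun x hx =>
    (Metric.closedBall_subset_ball (htr x hx).2.2).trans (hRsub x (htS hx).1)
  have hcov : volume (unitCube n \ ⋃ x ∈ t, Metric.closedBall x (r x)) = 0 := by
    refine measure_mono_null (fun y hy => ?_) (measure_union_null hSae htcov)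
    by_cases hyS : y ∈ S
    · exact Or.inr ⟨hyS, hy.2⟩
    · exact Or.inl ⟨hy.1, hyS⟩
  obtain ⟨F, hFt, hFvol⟩ := exists_finset_volume_diff_le htc
    (fun x => measurableSet_closedBall) hBsub htd hcov hε
  have hr0 : ∀ x ∈ F, 0 < r x := fun x hx => (htr x (hFt hx)).2.1
  have hresc : ∀ x ∈ F, IsTestMap (rescale (ψ x) x (r x)) := fun x hx =>
    (hψ x).rescale (hr0 x hx) (Metric.ball_subset_closedBall.trans (hBsub x (hFt hx)))
  set σ : (Fin n → ℝ) → (Fin m → ℝ) := fun y => ∑ x ∈ F, rescale (ψ x) x (r x) y with hσ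
  have hσt : IsTestMap σ := IsTestMap.sum F hresc
  set w : (Fin n → ℝ) → (Fin m → ℝ) := fun y => φ y + σ y with hw
  have hwt : IsTestMap w := hφ.add hσt
  have hwg : ∀ y, ξ + gradMatrix w y
      = ξ + gradMatrix φ y + ∑ x ∈ F, gradMatrix (rescale (ψ x) x (r x)) y := by
    intro y
    rw [hw, gradMatrix_add hφ.differentiable hσt.differentiable, hσ,
      gradMatrix_sum F fun x hx => (hresc x hx).differentiable, add_assoc]
  have hzero : ∀ x ∈ F, ∀ y ∉ Metric.closedBall x (r x),
      gradMatrix (rescale (ψ x) x (r x)) y = 0 := by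
    intro x hx y hy
    rw [gradMatrix_rescale (hψ x) x (hr0 x hx)]
    apply gradMatrix_eq_zero_of_notMem_unitCube (hψ x)
    rw [smul_sub_mem_unitCube_iff (hr0 x hx)]
    exact fun h => hy (Metric.ball_subset_closedBall h)
  have hwin : ∀ x ∈ F, ∀ y ∈ Metric.closedBall x (r x), ξ + gradMatrix w y
      = ξ + gradMatrix φ y + gradMatrix (rescale (ψ x) x (r x)) y := by
    intro x hx y hy
    rw [hwg, Finset.sum_eq_single x]
    · intro x' hx' hne
      refine hzero x' hx' y fun hy' => ?_
      exact Set.disjoint_left.mp (htd (hFt hx') (hFt hx) hne) hy' hy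
    · exact fun h => absurd hx h
  set A := ⋃ x ∈ F, Metric.closedBall x (r x) with hA
  have hAm : MeasurableSet A := F.measurableSet_biUnion fun x _ => measurableSet_closedBall
  have hAsub : A ⊆ unitCube n := iUnion₂_subset fun x hx => hBsub x (hFt hx)
  have hwout : ∀ y ∉ A, ξ + gradMatrix w y = ξ + gradMatrix φ y := by
    intro y hy
    rw [hwg, Finset.sum_eq_zero, add_zero]
    intro x hx
    exact hzero x hx y fun h => hy (mem_iUnion₂.mpr ⟨x, hx, h⟩)
  have hwc : Continuous fun y => h (ξ + gradMatrix w y) :=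
    hc.comp (continuous_const.add hwt.continuous_gradMatrix)
  have hdisjF : (F : Set (Fin n → ℝ)).Pairwise
      (Function.onFun Disjoint fun x => Metric.closedBall x (r x)) := htd.subset hFt
  have hHε : IntegrableOn (fun y => H y + 3 * ε) (unitCube n) :=
    hHQ.add (integrableOn_const (by rw [volume_unitCube]; exact ENNReal.one_ne_top) enorm_ne_top)
  have hin : ∫ y in A, h (ξ + gradMatrix w y) ≤ ∫ y in A, (H y + 3 * ε) := by
    rw [hA, integral_biUnion_finset F (fun x _ => measurableSet_closedBall) hdisjF
        fun x _ => hwc.continuousOn.integrableOn_compact (isCompact_closedBall _ _),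
      integral_biUnion_finset F (fun x _ => measurableSet_closedBall) hdisjF
        fun x hx => hHε.mono_set (hBsub x (hFt hx))]
    refine Finset.sum_le_sum fun x hx => ?_
    rw [setIntegral_congr_fun measurableSet_closedBall
      (fun y hy => congrArg h (hwin x hx y hy))]
    have hp := (hmemP x (r x)).mp (htr x (hFt hx)).1
    refine hp.trans_eq ?_
    rw [integral_add (hHQ.mono_set (hBsub x (hFt hx)))
      (integrableOn_const measure_closedBall_lt_top.ne enorm_ne_top), setIntegral_const,
      volume_real_closedBall_pi x (hr0 x hx).le, smul_eq_mul, mul_comm (3 * ε)]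
  have hout : ∫ y in unitCube n \ A, h (ξ + gradMatrix w y) ≤ M' * ε := by
    have hfin : volume (unitCube n \ A) ≠ ⊤ := ne_top_of_le_ne_top ENNReal.ofReal_ne_top hFvol
    calc ∫ y in unitCube n \ A, h (ξ + gradMatrix w y) ≤ ∫ y in unitCube n \ A, M' := by
          refine setIntegral_mono_on (hwc.integrableOn_unitCube.mono_set sdiff_subset)
            (integrableOn_const hfin enorm_ne_top) ((measurableSet_unitCube n).diff hAm)
            fun y hy => ?_
          rw [hwout y hy.2]
          exact hM' y hy.1
      _ = volume.real (unitCube n \ A) * M' := by rw [setIntegral_const, smul_eq_mul]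
      _ ≤ ε * M' := by
          gcongr
          exact ENNReal.toReal_le_of_le_ofReal hε.le hFvol
      _ = M' * ε := mul_comm _ _
  calc testEnvelope h ξ ≤ ∫ y in unitCube n, h (ξ + gradMatrix w y) :=
        testEnvelope_le_integral h0 ξ hwt
    _ = (∫ y in A, h (ξ + gradMatrix w y)) + ∫ y in unitCube n \ A, h (ξ + gradMatrix w y) := by
        rw [← integral_inter_add_sdiff hAm hwc.integrableOn_unitCube,
          inter_eq_self_of_subset_right hAsub]
    _ ≤ (∫ y in unitCube n, (H y + 3 * ε)) + M' * ε := by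
        refine add_le_add (hin.trans ?_) hout
        refine setIntegral_mono_set hHε (ae_of_all _ fun y => ?_) hAsub.eventuallyLE
        have := hH0 y
        simp only [Pi.zero_apply]; positivity
    _ = (∫ y in unitCube n, H y) + ε' := by
        rw [integral_add hHQ (integrableOn_const
          (by rw [volume_unitCube]; exact ENNReal.one_ne_top) enorm_ne_top), setIntegral_const,
          Measure.real, volume_unitCube, ENNReal.toReal_one, one_smul, add_assoc, ← add_mul,
          hεdef, mul_div_cancel₀]
        positivity

end testEnvelope

/-! ### Norms of gradient matrices and quasiconvex envelopes -/

theorem frobNorm_nonneg {m n : ℕ} (ξ : Matrix (Fin m) (Fin n) ℝ) : 0 ≤ frobNorm ξ :=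
  Real.sqrt_nonneg _

theorem frobNorm_sub_le {m n : ℕ} (ξ η : Matrix (Fin m) (Fin n) ℝ) :
    frobNorm (ξ - η) ≤ frobNorm ξ + frobNorm η := by
  let := Matrix.frobeniusNormedAddCommGroup (m := Fin m) (n := Fin n) (α := ℝ)
  have h : ∀ A : Matrix (Fin m) (Fin n) ℝ, frobNorm A = ‖A‖ := by
    intro A
    rw [Matrix.frobenius_norm_def, frobNorm, Real.sqrt_eq_rpow]
    simp
  rw [h, h, h]
  exact norm_sub_le ξ η

theorem frobNorm_neg {m n : ℕ} (ξ : Matrix (Fin m) (Fin n) ℝ) : frobNorm (-ξ) = frobNorm ξ := by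
  simp [frobNorm]

theorem frobNorm_add_le {m n : ℕ} (ξ η : Matrix (Fin m) (Fin n) ℝ) :
    frobNorm (ξ + η) ≤ frobNorm ξ + frobNorm η := by
  have := frobNorm_sub_le ξ (-η)
  rwa [sub_neg_eq_add, frobNorm_neg] at this

theorem frobNorm_gradMatrix_le {m n : ℕ} (φ : (Fin n → ℝ) → (Fin m → ℝ)) (x : Fin n → ℝ) :
    frobNorm (gradMatrix φ x) ≤ (m * n + n + 1) * ‖fderiv ℝ φ x‖ := by
  rw [frobNorm]
  apply Real.sqrt_le_iff.mpr
  refine ⟨by positivity, ?_⟩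
  have h : ∀ i j, gradMatrix φ x i j ^ 2 ≤ ‖fderiv ℝ φ x‖ ^ 2 := by
    intro i j
    rw [← sq_abs]
    gcongr
    rw [gradMatrix, Matrix.of_apply, ← Real.norm_eq_abs]
    refine (norm_le_pi_norm _ i).trans ((ContinuousLinearMap.le_opNorm _ _).trans_eq ?_)
    rw [Pi.norm_single, norm_one, mul_one]
  calc ∑ i, ∑ j, gradMatrix φ x i j ^ 2 ≤ ∑ _i : Fin m, ∑ _j : Fin n, ‖fderiv ℝ φ x‖ ^ 2 :=
        Finset.sum_le_sum fun i _ => Finset.sum_le_sum fun j _ => h i j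
    _ = (m * n) * ‖fderiv ℝ φ x‖ ^ 2 := by simp [mul_assoc]
    _ ≤ (m * n + n + 1) ^ 2 * ‖fderiv ℝ φ x‖ ^ 2 := by
        gcongr
        have h1 : (0 : ℝ) ≤ m * n := by positivity
        have h2 : (0 : ℝ) ≤ n := by positivity
        nlinarith [mul_nonneg h1 h1, mul_nonneg h1 h2]
    _ = _ := by ring

theorem norm_fderiv_le_frobNorm {m n : ℕ} (φ : (Fin n → ℝ) → (Fin m → ℝ)) (x : Fin n → ℝ) :
    ‖fderiv ℝ φ x‖ ≤ (m * n + n + 1) * frobNorm (gradMatrix φ x) := by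
  have hf := frobNorm_nonneg (gradMatrix φ x)
  have hentry : ∀ i j, |gradMatrix φ x i j| ≤ frobNorm (gradMatrix φ x) := by
    intro i j
    rw [frobNorm]
    apply Real.abs_le_sqrt
    refine le_trans ?_ (Finset.single_le_sum (f := fun i => ∑ j, gradMatrix φ x i j ^ 2)
      (fun i _ => Finset.sum_nonneg fun j _ => sq_nonneg _) (Finset.mem_univ i))
    exact Finset.single_le_sum (f := fun j => gradMatrix φ x i j ^ 2)
      (fun j _ => sq_nonneg _) (Finset.mem_univ j)
  refine ContinuousLinearMap.opNorm_le_bound _ (by positivity) fun v => ?_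
  refine (pi_norm_le_iff_of_nonneg (by positivity)).mpr fun i => ?_
  have hv : fderiv ℝ φ x v i = ∑ j, v j * gradMatrix φ x i j := by
    conv_lhs => rw [← Finset.univ_sum_single v]
    rw [map_sum, Finset.sum_apply]
    refine Finset.sum_congr rfl fun j _ => ?_
    have : (Pi.single j (v j) : Fin n → ℝ) = v j • Pi.single j 1 := by
      rw [← Pi.single_smul, smul_eq_mul, mul_one]
    rw [this, map_smul, Pi.smul_apply, smul_eq_mul, gradMatrix, Matrix.of_apply]
  rw [hv]
  calc ‖∑ j, v j * gradMatrix φ x i j‖ ≤ ∑ j, ‖v j * gradMatrix φ x i j‖ := norm_sum_le _ _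
    _ ≤ ∑ _j : Fin n, ‖v‖ * frobNorm (gradMatrix φ x) := by
        refine Finset.sum_le_sum fun j _ => ?_
        rw [norm_mul]
        exact mul_le_mul (norm_le_pi_norm v j) (hentry i j) (norm_nonneg _) (norm_nonneg _)
    _ = n * frobNorm (gradMatrix φ x) * ‖v‖ := by simp; ring
    _ ≤ _ := by
        gcongr
        have h1 : (0 : ℝ) ≤ m * n := by positivity
        linarith

theorem tendsto_gradMatrix {m n : ℕ} {ψ : ℕ → (Fin n → ℝ) → (Fin m → ℝ)}
    {φ : (Fin n → ℝ) → (Fin m → ℝ)} {x : Fin n → ℝ}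
    (h : Tendsto (fun k => fderiv ℝ (ψ k) x) atTop (𝓝 (fderiv ℝ φ x))) :
    Tendsto (fun k => gradMatrix (ψ k) x) atTop (𝓝 (gradMatrix φ x)) := by
  have hc : Continuous fun A : (Fin n → ℝ) →L[ℝ] (Fin m → ℝ) =>
      (Matrix.of fun i j => A (Pi.single j 1) i : Matrix (Fin m) (Fin n) ℝ) :=
    continuous_matrix fun i j => by simp only [Matrix.of_apply]; fun_prop
  exact (hc.tendsto _).comp h

theorem isQuasiconvex_testEnvelope {m n : ℕ} {h : Matrix (Fin m) (Fin n) ℝ → ℝ}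
    (hc : Continuous h) (h0 : ∀ η, 0 ≤ h η)
    (hb : ∀ R : ℝ, ∃ C : ℝ, ∀ η, frobNorm η ≤ R → h η ≤ C) :
    IsQuasiconvex (testEnvelope h) where
  measurable := by
    let : MeasurableSpace (Matrix (Fin m) (Fin n) ℝ) := borel _
    have : BorelSpace (Matrix (Fin m) (Fin n) ℝ) := ⟨rfl⟩
    exact (upperSemicontinuous_testEnvelope hc h0).measurable
  locallyBounded := fun R => by
    obtain ⟨C, hC⟩ := hb R
    refine ⟨C, fun η hη => ?_⟩
    rw [abs_of_nonneg (testEnvelope_nonneg h0 η)]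
    exact (testEnvelope_le h0 η).trans (hC η hη)
  le_integral := fun ξ _ hφ => testEnvelope_le_integral_testEnvelope hc h0 ξ hφ

theorem testEnvelope_le_qcEnvelope {m n : ℕ} {h : Matrix (Fin m) (Fin n) ℝ → ℝ}
    (hc : Continuous h) (h0 : ∀ η, 0 ≤ h η)
    (hb : ∀ R : ℝ, ∃ C : ℝ, ∀ η, frobNorm η ≤ R → h η ≤ C) (ξ : Matrix (Fin m) (Fin n) ℝ) :
    testEnvelope h ξ ≤ qcEnvelope h ξ :=
  (isLUB_qcEnvelope h0 ξ).1
    ⟨_, isQuasiconvex_testEnvelope hc h0 hb, testEnvelope_le h0, rfl⟩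

theorem IsQuasiconvex.le_integral_of_le {m n : ℕ} {Φ h : Matrix (Fin m) (Fin n) ℝ → ℝ}
    (hΦ : IsQuasiconvex Φ) (hc : Continuous h) (hle : ∀ η, Φ η ≤ h η)
    (ξ : Matrix (Fin m) (Fin n) ℝ) {φ : (Fin n → ℝ) → (Fin m → ℝ)} (hφ : IsTestMap φ) :
    Φ ξ ≤ ∫ x in unitCube n, h (ξ + gradMatrix φ x) := by
  have hGc : Continuous fun x => ξ + gradMatrix φ x :=
    continuous_const.add hφ.continuous_gradMatrix
  refine (hΦ.le_integral ξ φ hφ).trans (integral_mono ?_ (hc.comp hGc).integrableOn_unitCube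
    fun x => hle _)
  have hm : Measurable fun x => Φ (ξ + gradMatrix φ x) := by
    let : MeasurableSpace (Matrix (Fin m) (Fin n) ℝ) := borel _
    have : BorelSpace (Matrix (Fin m) (Fin n) ℝ) := ⟨rfl⟩
    exact hΦ.measurable.comp hGc.measurable
  obtain ⟨G, hG⟩ := (isCompact_closedBall (0 : Fin n → ℝ) (1 / 2)).bddAbove_image
    (hφ.continuous_fderiv.norm.continuousOn)
  obtain ⟨C, hC⟩ := hΦ.locallyBounded (frobNorm ξ + (m * n + n + 1) * G)
  have : IsFiniteMeasure (volume.restrict (unitCube n)) :=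
    ⟨by rw [Measure.restrict_apply_univ, volume_unitCube]; exact ENNReal.one_lt_top⟩
  refine Integrable.of_bound (C := C) hm.aestronglyMeasurable ?_
  refine (ae_restrict_iff' (measurableSet_unitCube n)).mpr (ae_of_all _ fun x hx => ?_)
  refine hC _ ((frobNorm_add_le _ _).trans ?_)
  gcongr
  refine (frobNorm_gradMatrix_le φ x).trans ?_
  gcongr
  exact hG ⟨x, unitCube_subset_closedBall n hx, rfl⟩

theorem qcEnvelope_nonneg {m n : ℕ} {h : Matrix (Fin m) (Fin n) ℝ → ℝ} (h0 : ∀ η, 0 ≤ h η)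
    (ξ : Matrix (Fin m) (Fin n) ℝ) : 0 ≤ qcEnvelope h ξ :=
  (isLUB_qcEnvelope h0 ξ).1 ⟨_, isQuasiconvex_zero, h0, rfl⟩

theorem qcEnvelope_le {m n : ℕ} {h : Matrix (Fin m) (Fin n) ℝ → ℝ} (h0 : ∀ η, 0 ≤ h η)
    (ξ : Matrix (Fin m) (Fin n) ℝ) : qcEnvelope h ξ ≤ h ξ := by
  refine (isLUB_qcEnvelope h0 ξ).2 ?_
  rintro _ ⟨Φ, _, hle, rfl⟩
  exact hle ξ

theorem qcEnvelope_mono {m n : ℕ} {h k : Matrix (Fin m) (Fin n) ℝ → ℝ} (h0 : ∀ η, 0 ≤ h η)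
    (hk : ∀ η, h η ≤ k η) (ξ : Matrix (Fin m) (Fin n) ℝ) : qcEnvelope h ξ ≤ qcEnvelope k ξ := by
  refine (isLUB_qcEnvelope h0 ξ).2 ?_
  rintro _ ⟨Φ, hΦ, hle, rfl⟩
  exact (isLUB_qcEnvelope (fun η => (h0 η).trans (hk η)) ξ).1
    ⟨Φ, hΦ, fun η => (hle η).trans (hk η), rfl⟩

/-! ### Truncations of linear growth -/

theorem sum_ite_pow_le {ρ : ℝ} (hρ : 1 < ρ) (J : ℕ) (P : ℕ → Prop) [DecidablePred P] :
    ∑ j ∈ Finset.range J, (if P j then ρ ^ j else 0) ≤ ρ ^ J / (ρ - 1) := by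
  have h1 : 0 < ρ - 1 := by linarith
  calc ∑ j ∈ Finset.range J, (if P j then ρ ^ j else 0) ≤ ∑ j ∈ Finset.range J, ρ ^ j := by
        refine Finset.sum_le_sum fun j _ => ?_
        split_ifs
        · exact le_rfl
        · positivity
    _ = (ρ ^ J - 1) / (ρ - 1) := geom_sum_eq hρ.ne' J
    _ ≤ _ := by gcongr; linarith

/-- The geometric sum of `(2 ^ (q - 1)) ^ j = (2 ^ j) ^ (q - 1)` over the dyadic levels below `G` is
at most a multiple of `G ^ (q - 1)`, however many levels are admitted. -/
theorem sum_ite_pow_lt_le {q : ℝ} (hq : 1 < q) {G : ℝ} (hG : 0 ≤ G) (J : ℕ) :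
    ∑ j ∈ Finset.range J, (if (2 : ℝ) ^ j < G then ((2 : ℝ) ^ (q - 1)) ^ j else 0)
      ≤ (2 : ℝ) ^ (q - 1) / ((2 : ℝ) ^ (q - 1) - 1) * G ^ (q - 1) := by
  set ρ : ℝ := (2 : ℝ) ^ (q - 1) with hρdef
  have hρ : 1 < ρ := Real.one_lt_rpow (by norm_num) (by linarith)
  have h1 : 0 < ρ - 1 := by linarith
  induction J with
  | zero => simp only [Finset.range_zero, Finset.sum_empty]; positivity
  | succ J ih =>
    by_cases h : (2 : ℝ) ^ J < G
    · have e1 : ρ ^ J ≤ G ^ (q - 1) := by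
        rw [hρdef, ← Real.rpow_natCast, ← Real.rpow_mul (by norm_num), mul_comm,
          Real.rpow_mul (by norm_num), Real.rpow_natCast]
        exact Real.rpow_le_rpow (by positivity) h.le (by linarith)
      refine (sum_ite_pow_le hρ (J + 1) fun j => (2 : ℝ) ^ j < G).trans ?_
      rw [pow_succ, mul_div_assoc, mul_comm]
      gcongr
    · rw [Finset.sum_range_succ, if_neg h, add_zero]
      exact ih

/-- The truncation `Ψ ∧ K Ψ^{1/q}`, of linear growth when `Ψ` has growth of order `q`. -/
noncomputable def linearTrunc {m n : ℕ} (Ψ : Matrix (Fin m) (Fin n) ℝ → ℝ) (q K : ℝ)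
    (ξ : Matrix (Fin m) (Fin n) ℝ) : ℝ :=
  min (Ψ ξ) (K * Ψ ξ ^ (1 / q))

section linearTrunc

variable {m n : ℕ} {Ψ : Matrix (Fin m) (Fin n) ℝ → ℝ} {q c : ℝ}

theorem linearTrunc_nonneg (h0 : ∀ η, 0 ≤ Ψ η) {K : ℝ} (hK : 0 ≤ K)
    (η : Matrix (Fin m) (Fin n) ℝ) : 0 ≤ linearTrunc Ψ q K η :=
  le_min (h0 η) (mul_nonneg hK (Real.rpow_nonneg (h0 η) _))

theorem continuous_linearTrunc (hΨ : Continuous Ψ) (hq : 1 < q) (K : ℝ) :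
    Continuous (linearTrunc Ψ q K) :=
  hΨ.min (continuous_const.mul (hΨ.rpow_const fun _ => Or.inr (by positivity)))

theorem linearTrunc_eq_self (h0 : ∀ η, 0 ≤ Ψ η) (hq : 1 < q) {K W : ℝ}
    (hW : W ^ (1 - 1 / q) ≤ K) {η : Matrix (Fin m) (Fin n) ℝ} (hη : Ψ η ≤ W) :
    linearTrunc Ψ q K η = Ψ η := by
  apply min_eq_left
  have h1 : 1 / q < 1 := by rw [div_lt_one (by linarith)]; exact hq
  calc Ψ η = Ψ η ^ (1 - 1 / q) * Ψ η ^ (1 / q) := by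
        rw [← Real.rpow_add' (h0 η) (by norm_num), sub_add_cancel, Real.rpow_one]
    _ ≤ K * Ψ η ^ (1 / q) := by
        gcongr
        · exact Real.rpow_nonneg (h0 η) _
        · exact (Real.rpow_le_rpow (h0 η) hη (by linarith)).trans hW

/-- The sum over dyadic levels `2 ^ j` of `(2 ^ j) ^ (q - 1) (g - 2 ^ j / 2)⁺` is dominated by the
truncated integrand, uniformly in the number of levels and in the truncation parameter. -/
theorem exists_sum_dyadic_le_linearTrunc (h0 : ∀ η, 0 ≤ Ψ η) (hq : 1 < q) {A : ℝ} (hA : 0 ≤ A) :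
    ∃ B : ℝ, 0 ≤ B ∧ ∀ (J : ℕ) (K : ℝ), 1 ≤ K → ((2 : ℝ) ^ (q - 1)) ^ J ≤ K →
      ∀ (η : Matrix (Fin m) (Fin n) ℝ) (g : ℝ), 0 ≤ g → g ≤ A * (Ψ η + 1) ^ (1 / q) →
        ∑ j ∈ Finset.range J, ((2 : ℝ) ^ (q - 1)) ^ j * max (g - 2 ^ j / 2) 0
          ≤ B * (linearTrunc Ψ q K η + 1) := by
  set ρ : ℝ := (2 : ℝ) ^ (q - 1) with hρdef
  have hρ : 1 < ρ := Real.one_lt_rpow (by norm_num) (by linarith)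
  have hρ1 : 0 < ρ - 1 := by linarith
  have hq0 : 0 < q := by linarith
  set B1 := ρ / (ρ - 1) * ρ * A ^ q with hB1
  set B2 := 2 * A / (ρ - 1) with hB2
  have hB1n : 0 ≤ B1 := by positivity
  have hB2n : 0 ≤ B2 := by positivity
  refine ⟨B1 + B2, by positivity, fun J K hK1 hKJ η g hg hgA => ?_⟩
  have hΨ0 := h0 η
  set S := ∑ j ∈ Finset.range J, (if (2 : ℝ) ^ j < 2 * g then ρ ^ j else 0) with hS
  have hterm : ∑ j ∈ Finset.range J, ρ ^ j * max (g - 2 ^ j / 2) 0 ≤ g * S := by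
    rw [hS, Finset.mul_sum]
    refine Finset.sum_le_sum fun j _ => ?_
    have hp : (0 : ℝ) < 2 ^ j := by positivity
    split_ifs with h
    · rw [mul_comm]
      gcongr
      exact max_le (by linarith) hg
    · rw [max_eq_right (by linarith)]; simp
  refine hterm.trans ?_
  have hlin0 : 0 ≤ linearTrunc Ψ q K η := linearTrunc_nonneg h0 (by linarith) η
  rcases le_or_gt (Ψ η) (K * Ψ η ^ (1 / q)) with hcase | hcase
  · have hlt : linearTrunc Ψ q K η = Ψ η := min_eq_left hcase
    have hS1 : S ≤ ρ / (ρ - 1) * (2 * g) ^ (q - 1) :=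
      sum_ite_pow_lt_le hq (by positivity) J
    have hgq : g ^ q ≤ A ^ q * (Ψ η + 1) := by
      calc g ^ q ≤ (A * (Ψ η + 1) ^ (1 / q)) ^ q := Real.rpow_le_rpow hg hgA hq0.le
        _ = A ^ q * (Ψ η + 1) := by
            rw [Real.mul_rpow hA (by positivity), ← Real.rpow_mul (by positivity),
              one_div_mul_cancel hq0.ne', Real.rpow_one]
    calc g * S ≤ g * (ρ / (ρ - 1) * (2 * g) ^ (q - 1)) := by gcongr
      _ = ρ / (ρ - 1) * ρ * (g ^ (1 : ℝ) * g ^ (q - 1)) := by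
          rw [Real.mul_rpow (by norm_num) hg, Real.rpow_one, ← hρdef]; ring
      _ = ρ / (ρ - 1) * ρ * g ^ q := by
          rw [← Real.rpow_add' hg (by linarith)]; ring_nf
      _ ≤ ρ / (ρ - 1) * ρ * (A ^ q * (Ψ η + 1)) := by gcongr
      _ = B1 * (Ψ η + 1) := by rw [hB1]; ring
      _ ≤ (B1 + B2) * (linearTrunc Ψ q K η + 1) := by
          rw [hlt]; gcongr; linarith
  · have hlt : linearTrunc Ψ q K η = K * Ψ η ^ (1 / q) := min_eq_right hcase.le
    -- in this regime `Ψ ≥ 1`, so that `Ψ + 1` may be replaced by `2 Ψ`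
    have hΨ1 : 1 ≤ Ψ η := by
      by_contra! h
      have h1 : Ψ η ≤ Ψ η ^ (1 / q) := by
        conv_lhs => rw [← Real.rpow_one (Ψ η)]
        refine Real.rpow_le_rpow_of_exponent_ge_of_imp hΨ0 h.le
          (by rw [div_le_one hq0]; exact hq.le) fun _ h => ?_
        exact absurd h (by positivity)
      have h2 : Ψ η ^ (1 / q) ≤ K * Ψ η ^ (1 / q) :=
        le_mul_of_one_le_left (Real.rpow_nonneg hΨ0 _) hK1
      linarith
    have hS2 : S ≤ ρ ^ J / (ρ - 1) := sum_ite_pow_le hρ J _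
    have h2 : (Ψ η + 1) ^ (1 / q) ≤ 2 * Ψ η ^ (1 / q) := by
      calc (Ψ η + 1) ^ (1 / q) ≤ (2 * Ψ η) ^ (1 / q) :=
            Real.rpow_le_rpow (by linarith) (by linarith) (by positivity)
        _ = 2 ^ (1 / q) * Ψ η ^ (1 / q) := Real.mul_rpow (by norm_num) hΨ0
        _ ≤ 2 ^ (1 : ℝ) * Ψ η ^ (1 / q) := by
            gcongr
            · norm_num
            · rw [div_le_one hq0]; exact hq.le
        _ = _ := by rw [Real.rpow_one]
    calc g * S ≤ (A * (Ψ η + 1) ^ (1 / q)) * (ρ ^ J / (ρ - 1)) := by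
          gcongr
      _ ≤ (A * (2 * Ψ η ^ (1 / q))) * (K / (ρ - 1)) := by gcongr
      _ = B2 * (K * Ψ η ^ (1 / q)) := by rw [hB2]; ring
      _ ≤ (B1 + B2) * (linearTrunc Ψ q K η + 1) := by
          rw [← hlt]; gcongr <;> linarith

/-- Coercivity: a shifted norm is controlled by `(Ψ + 1)^{1/q}`. -/
theorem exists_mul_frobNorm_add_le (hq : 1 < q) (hc : 0 < c)
    (hlower : ∀ ξ, max (1 / c * frobNorm ξ ^ q - c) 0 ≤ Ψ ξ) {D R : ℝ} (hD : 0 ≤ D) (hR : 0 ≤ R) :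
    ∃ A : ℝ, 0 ≤ A ∧ ∀ η, D * (frobNorm η + R) ≤ A * (Ψ η + 1) ^ (1 / q) := by
  have hq0 : 0 < q := by linarith
  refine ⟨D * ((c * (1 + c)) ^ (1 / q) + R), by positivity, fun η => ?_⟩
  have h0 : 0 ≤ Ψ η := (le_max_right _ _).trans (hlower η)
  have hl : 1 / c * frobNorm η ^ q - c ≤ Ψ η := (le_max_left _ _).trans (hlower η)
  have h1 : frobNorm η ^ q ≤ c * (1 + c) * (Ψ η + 1) := by
    have : frobNorm η ^ q ≤ c * (Ψ η + c) := by
      have h2 : 1 / c * frobNorm η ^ q ≤ Ψ η + c := by linarith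
      rwa [one_div, inv_mul_le_iff₀ hc] at h2
    refine this.trans ?_
    rw [mul_assoc]
    gcongr
    nlinarith
  have h2 : frobNorm η ≤ (c * (1 + c)) ^ (1 / q) * (Ψ η + 1) ^ (1 / q) := by
    rw [← Real.mul_rpow (by positivity) (by positivity)]
    calc frobNorm η = (frobNorm η ^ q) ^ (1 / q) := by
          rw [← Real.rpow_mul (frobNorm_nonneg η), mul_one_div_cancel hq0.ne', Real.rpow_one]
      _ ≤ _ := Real.rpow_le_rpow (Real.rpow_nonneg (frobNorm_nonneg η) _) h1 (by positivity)
  have h3 : R ≤ R * (Ψ η + 1) ^ (1 / q) :=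
    le_mul_of_one_le_right hR (Real.one_le_rpow (by linarith) (by positivity))
  calc D * (frobNorm η + R)
      ≤ D * ((c * (1 + c)) ^ (1 / q) * (Ψ η + 1) ^ (1 / q) + R * (Ψ η + 1) ^ (1 / q)) := by gcongr
    _ = _ := by ring

end linearTrunc

/-! ### Passing to the limit in the truncation -/

/-- Among the first `J` dyadic levels there is one at which the maximal-function estimate of the
Lipschitz truncation gains a factor `1 / J`. -/
theorem exists_level_le {m n : ℕ} {Ψ : Matrix (Fin m) (Fin n) ℝ → ℝ} {q B K : ℝ}
    (hcont : Continuous (linearTrunc Ψ q K)) {ξ : Matrix (Fin m) (Fin n) ℝ}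
    {φ : (Fin n → ℝ) → (Fin m → ℝ)} (hφ : IsTestMap φ) {J : ℕ} (hJ : 0 < J)
    (hsum : ∀ x, ∑ j ∈ Finset.range J,
        ((2 : ℝ) ^ (q - 1)) ^ j * max (‖fderiv ℝ φ x‖ - 2 ^ j / 2) 0
      ≤ B * (linearTrunc Ψ q K (ξ + gradMatrix φ x) + 1)) :
    ∃ j < J, ((2 : ℝ) ^ (q - 1)) ^ j * ∫ x in unitCube n, max (‖fderiv ℝ φ x‖ - 2 ^ j / 2) 0
      ≤ B * ((∫ x in unitCube n, linearTrunc Ψ q K (ξ + gradMatrix φ x)) + 1) / J := by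
  have hJ' : (0 : ℝ) < J := by exact_mod_cast hJ
  have hgc := hφ.continuous_fderiv.norm
  have hic : Continuous fun x => linearTrunc Ψ q K (ξ + gradMatrix φ x) :=
    hcont.comp (continuous_const.add hφ.continuous_gradMatrix)
  have hjc : ∀ j : ℕ, Continuous fun x => ((2 : ℝ) ^ (q - 1)) ^ j *
      max (‖fderiv ℝ φ x‖ - 2 ^ j / 2) 0 := fun j => by fun_prop
  have hone : IntegrableOn (fun _ : Fin n → ℝ => (1 : ℝ)) (unitCube n) :=
    continuous_const.integrableOn_unitCube
  have hint : ∑ j ∈ Finset.range J, ∫ x in unitCube n,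
      ((2 : ℝ) ^ (q - 1)) ^ j * max (‖fderiv ℝ φ x‖ - 2 ^ j / 2) 0
      ≤ B * ((∫ x in unitCube n, linearTrunc Ψ q K (ξ + gradMatrix φ x)) + 1) := by
    rw [← integral_finsetSum _ fun j _ => (hjc j).integrableOn_unitCube]
    calc _ ≤ ∫ x in unitCube n, B * (linearTrunc Ψ q K (ξ + gradMatrix φ x) + 1) :=
          integral_mono (continuous_finsetSum _ fun j _ => hjc j).integrableOn_unitCube
            (continuous_const.mul (hic.add continuous_const)).integrableOn_unitCube hsum
      _ = _ := by
          rw [integral_const_mul, integral_add hic.integrableOn_unitCube hone]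
          simp [Measure.real, volume_unitCube]
  by_contra! hcon
  have hlt : ∑ j ∈ Finset.range J,
      B * ((∫ x in unitCube n, linearTrunc Ψ q K (ξ + gradMatrix φ x)) + 1) / J
      < ∑ j ∈ Finset.range J, ∫ x in unitCube n,
      ((2 : ℝ) ^ (q - 1)) ^ j * max (‖fderiv ℝ φ x‖ - 2 ^ j / 2) 0 := by
    refine Finset.sum_lt_sum_of_nonempty (Finset.nonempty_range_iff.mpr hJ.ne') fun j hj => ?_
    rw [integral_const_mul]
    exact hcon j (Finset.mem_range.mp hj)
  rw [Finset.sum_const, Finset.card_range, nsmul_eq_mul, mul_div_cancel₀ _ hJ'.ne'] at hlt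
  linarith

/-- If `Ψ` and its truncation agree at moderate gradients, then after a Lipschitz truncation at
level `lam` the full energy exceeds the truncated energy of `φ` by at most the energy on the
exceptional set. -/
theorem IsTestMap.exists_integral_le_of_level {m n : ℕ} {Ψ h : Matrix (Fin m) (Fin n) ℝ → ℝ}
    (hΨ : Continuous Ψ) (hh : Continuous h) (hΨ0 : ∀ η, 0 ≤ Ψ η) (h0 : ∀ η, 0 ≤ h η)
    {ξ : Matrix (Fin m) (Fin n) ℝ} {φ : (Fin n → ℝ) → (Fin m → ℝ)} (hφ : IsTestMap φ)
    {lam W : ℝ} (hl : 0 < lam)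
    (hW : ∀ η, frobNorm η ≤ frobNorm ξ + (m * n + n + 1) * (3 * 4 ^ n * lam) → Ψ η ≤ W)
    (hagree : ∀ η, frobNorm η ≤ frobNorm ξ + (m * n + n + 1) * lam → h η = Ψ η)
    {ε : ℝ} (hε : 0 < ε) :
    ∃ ψ : (Fin n → ℝ) → (Fin m → ℝ), IsTestMap ψ ∧
      ∫ x in unitCube n, Ψ (ξ + gradMatrix ψ x) ≤ (∫ x in unitCube n, h (ξ + gradMatrix φ x)) +
        W * (4 ^ n * (2 / lam * ∫ x in unitCube n, max (‖fderiv ℝ φ x‖ - lam / 2) 0)) + ε := by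
  obtain ⟨U, hUm, hUvol, hUφ, ψ, hψ, hψb, hψt⟩ := hφ.exists_lipschitz_truncation hl
  have hfin : IsFiniteMeasure (volume.restrict (unitCube n \ U)) := ⟨by
    rw [Measure.restrict_apply_univ]
    refine (measure_mono sdiff_subset).trans_lt ?_
    rw [volume_unitCube]; exact ENNReal.one_lt_top⟩
  have hmeas : MeasurableSet (unitCube n \ U) := (measurableSet_unitCube n).diff hUm
  have hbound : ∀ k x, Ψ (ξ + gradMatrix (ψ k) x) ≤ W := by
    intro k x
    refine hW _ ((frobNorm_add_le _ _).trans ?_)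
    gcongr
    refine (frobNorm_gradMatrix_le _ x).trans ?_
    gcongr
    exact hψb k x
  have hW0 : 0 ≤ W := (hΨ0 _).trans (hbound 0 0)
  have hψc : ∀ k, Continuous fun x => Ψ (ξ + gradMatrix (ψ k) x) := fun k =>
    hΨ.comp (continuous_const.add (hψ k).continuous_gradMatrix)
  have hhc : Continuous fun x => h (ξ + gradMatrix φ x) :=
    hh.comp (continuous_const.add hφ.continuous_gradMatrix)
  have hlim : Tendsto (fun k => ∫ x in unitCube n \ U, Ψ (ξ + gradMatrix (ψ k) x)) atTop
      (𝓝 (∫ x in unitCube n \ U, Ψ (ξ + gradMatrix φ x))) := by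
    refine tendsto_integral_of_dominated_convergence (fun _ => W)
      (fun k => (hψc k).aestronglyMeasurable) (integrable_const W)
      (fun k => ae_of_all _ fun x => ?_)
      ((ae_restrict_iff' hmeas).mpr ?_)
    · rw [Real.norm_of_nonneg (hΨ0 _)]
      exact hbound k x
    · filter_upwards [hψt] with x hx hxU
      exact (hΨ.tendsto _).comp (tendsto_const_nhds.add (tendsto_gradMatrix (hx hxU.2)))
  obtain ⟨k, hk⟩ := (hlim.eventually_lt_const
    (show _ < (∫ x in unitCube n \ U, Ψ (ξ + gradMatrix φ x)) + ε by linarith)).exists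
  refine ⟨ψ k, hψ k, ?_⟩
  have hgood : ∫ x in unitCube n \ U, Ψ (ξ + gradMatrix φ x)
      ≤ ∫ x in unitCube n, h (ξ + gradMatrix φ x) := by
    rw [setIntegral_congr_fun hmeas (g := fun x => h (ξ + gradMatrix φ x))]
    · exact setIntegral_mono_set hhc.integrableOn_unitCube (ae_of_all _ fun x => h0 _)
        sdiff_subset.eventuallyLE
    · intro x hx
      refine (hagree _ ((frobNorm_add_le _ _).trans ?_)).symm
      gcongr
      refine (frobNorm_gradMatrix_le _ x).trans ?_
      gcongr
      exact hUφ x hx.2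
  set V := 4 ^ n * (2 / lam * ∫ x in unitCube n, max (‖fderiv ℝ φ x‖ - lam / 2) 0) with hV
  have hV0 : 0 ≤ V := by
    have : 0 ≤ ∫ x in unitCube n, max (‖fderiv ℝ φ x‖ - lam / 2) 0 :=
      integral_nonneg fun x => le_max_right _ _
    positivity
  have hbad : ∫ x in unitCube n ∩ U, Ψ (ξ + gradMatrix (ψ k) x) ≤ W * V := by
    have hle : volume (unitCube n ∩ U) ≤ ENNReal.ofReal V :=
      (measure_mono inter_subset_right).trans hUvol
    calc ∫ x in unitCube n ∩ U, Ψ (ξ + gradMatrix (ψ k) x) ≤ ∫ x in unitCube n ∩ U, W :=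
          setIntegral_mono_on ((hψc k).integrableOn_unitCube.mono_set inter_subset_left)
            (integrableOn_const (ne_top_of_le_ne_top ENNReal.ofReal_ne_top hle) enorm_ne_top)
            ((measurableSet_unitCube n).inter hUm) fun x _ => hbound k x
      _ = volume.real (unitCube n ∩ U) * W := by rw [setIntegral_const, smul_eq_mul]
      _ ≤ V * W := by gcongr; exact ENNReal.toReal_le_of_le_ofReal hV0 hle
      _ = _ := mul_comm _ _
  rw [← integral_inter_add_sdiff hUm (hψc k).integrableOn_unitCube]
  linarith

/-- For a large truncation parameter, a competitor of bounded truncated energy can be replaced by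
one whose full energy is not appreciably larger than the truncated energy. -/
theorem exists_forall_integral_le_linearTrunc {m n : ℕ} {q c : ℝ} (hq : 1 < q) (hc : 0 < c)
    {Ψ : Matrix (Fin m) (Fin n) ℝ → ℝ} (hΨ : Continuous Ψ)
    (hlower : ∀ ξ, max (1 / c * frobNorm ξ ^ q - c) 0 ≤ Ψ ξ)
    (hupper : ∀ ξ, Ψ ξ ≤ c * (frobNorm ξ ^ q + 1)) (ξ : Matrix (Fin m) (Fin n) ℝ)
    (L : ℝ) {ε : ℝ} (hε : 0 < ε) :
    ∃ K₀ : ℝ, ∀ K, K₀ ≤ K → ∀ φ : (Fin n → ℝ) → (Fin m → ℝ), IsTestMap φ →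
      ∫ x in unitCube n, linearTrunc Ψ q K (ξ + gradMatrix φ x) ≤ L →
      ∃ ψ : (Fin n → ℝ) → (Fin m → ℝ), IsTestMap ψ ∧
        ∫ x in unitCube n, Ψ (ξ + gradMatrix ψ x)
          ≤ (∫ x in unitCube n, linearTrunc Ψ q K (ξ + gradMatrix φ x)) + ε := by
  have h0 : ∀ η, 0 ≤ Ψ η := fun η => (le_max_right _ _).trans (hlower η)
  have hq0 : 0 < q := by linarith
  set D : ℝ := m * n + n + 1 with hD
  have hD0 : 0 ≤ D := by positivity
  set R := frobNorm ξ with hR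
  have hR0 : 0 ≤ R := frobNorm_nonneg ξ
  obtain ⟨A, hA0, hA⟩ := exists_mul_frobNorm_add_le hq hc hlower hD0 hR0
  obtain ⟨B, hB0, hB⟩ := exists_sum_dyadic_le_linearTrunc h0 hq hA0
  set ρ : ℝ := (2 : ℝ) ^ (q - 1) with hρ
  have hρ1 : 1 ≤ ρ := Real.one_le_rpow (by norm_num) (by linarith)
  set E := c * ((R + D * (3 * 4 ^ n)) ^ q + 1) with hE
  have hE0 : 0 ≤ E := by positivity
  -- the number of levels makes the energy on the exceptional set at most `ε / 2`
  obtain ⟨J, hJ⟩ := exists_nat_gt (max 0 (E * (4 ^ n * 2) * (B * (L + 1)) / (ε / 2)))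
  have hJ0 : (0 : ℝ) < J := (le_max_left _ _).trans_lt hJ
  have hJε : E * (4 ^ n * 2) * (B * (L + 1)) / J ≤ ε / 2 := by
    have := ((le_max_right _ _).trans_lt hJ).le
    rw [div_le_iff₀ (by positivity)] at this
    rw [div_le_iff₀ hJ0]
    linarith
  set W := c * ((R + D * 2 ^ J) ^ q + 1) with hW
  refine ⟨max (max 1 (ρ ^ J)) (W ^ (1 - 1 / q)), fun K hK φ hφ hL => ?_⟩
  have hK1 : 1 ≤ K := ((le_max_left _ _).trans (le_max_left _ _)).trans hK
  have hKJ : ρ ^ J ≤ K := ((le_max_right _ _).trans (le_max_left _ _)).trans hK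
  have hKW : W ^ (1 - 1 / q) ≤ K := (le_max_right _ _).trans hK
  have hcont := continuous_linearTrunc hΨ hq K
  have hsum : ∀ x, ∑ j ∈ Finset.range J, ρ ^ j * max (‖fderiv ℝ φ x‖ - 2 ^ j / 2) 0
      ≤ B * (linearTrunc Ψ q K (ξ + gradMatrix φ x) + 1) := by
    intro x
    refine hB J K hK1 hKJ _ _ (norm_nonneg _) (le_trans ?_ (hA _))
    refine (norm_fderiv_le_frobNorm φ x).trans ?_
    gcongr
    have := frobNorm_sub_le (ξ + gradMatrix φ x) ξ
    rwa [add_sub_cancel_left] at this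
  obtain ⟨j, hj, hjle⟩ := exists_level_le hcont hφ (by exact_mod_cast hJ0) hsum
  have hl1 : (1 : ℝ) ≤ 2 ^ j := one_le_pow₀ (by norm_num)
  have hl0 : (0 : ℝ) < 2 ^ j := by positivity
  have hup : ∀ η (r : ℝ), frobNorm η ≤ r → Ψ η ≤ c * (r ^ q + 1) := fun η r hr => by
    refine (hupper η).trans ?_
    have := Real.rpow_le_rpow (frobNorm_nonneg η) hr hq0.le
    gcongr
  have hbound : ∀ η, frobNorm η ≤ R + D * (3 * 4 ^ n * 2 ^ j) → Ψ η ≤ E * (2 ^ j) ^ q := by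
    intro η hη
    refine (hup η _ hη).trans ?_
    have h1 : R + D * (3 * 4 ^ n * 2 ^ j) ≤ (R + D * (3 * 4 ^ n)) * 2 ^ j := by nlinarith
    have h2 : (R + D * (3 * 4 ^ n * 2 ^ j)) ^ q ≤ (R + D * (3 * 4 ^ n)) ^ q * (2 ^ j) ^ q := by
      rw [← Real.mul_rpow (by positivity) (by positivity)]
      exact Real.rpow_le_rpow (by positivity) h1 hq0.le
    have h3 : (1 : ℝ) ≤ (2 ^ j) ^ q := Real.one_le_rpow hl1 hq0.le
    rw [hE, mul_assoc c]
    exact mul_le_mul_of_nonneg_left (by linarith) hc.le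
  have hagree : ∀ η, frobNorm η ≤ R + D * 2 ^ j → linearTrunc Ψ q K η = Ψ η := by
    intro η hη
    refine linearTrunc_eq_self h0 hq hKW (hup η _ (hη.trans ?_))
    gcongr
    norm_num
  obtain ⟨ψ, hψ, hψle⟩ := hφ.exists_integral_le_of_level hΨ hcont h0
    (linearTrunc_nonneg h0 (by linarith)) hl0 hbound hagree (half_pos hε)
  refine ⟨ψ, hψ, hψle.trans ?_⟩
  have hpow : ((2 : ℝ) ^ j) ^ q = ρ ^ j * 2 ^ j := by
    rw [hρ, ← Real.rpow_natCast 2 j, ← Real.rpow_mul_natCast (by norm_num),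
      ← Real.rpow_mul (by norm_num), ← Real.rpow_add (by norm_num)]
    ring_nf
  set I := ∫ x in unitCube n, max (‖fderiv ℝ φ x‖ - 2 ^ j / 2) 0 with hI
  have hbad : E * (2 ^ j) ^ q * (4 ^ n * (2 / 2 ^ j * I)) ≤ ε / 2 := by
    calc E * (2 ^ j) ^ q * (4 ^ n * (2 / 2 ^ j * I)) = E * (4 ^ n * 2) * (ρ ^ j * I) := by
          rw [hpow]; field_simp
      _ ≤ E * (4 ^ n * 2) * (B * (L + 1) / J) := by
          gcongr
          exact hjle.trans (by gcongr)
      _ = E * (4 ^ n * 2) * (B * (L + 1)) / J := by ring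
      _ ≤ ε / 2 := hJε
  linarith

/-- A bound on the envelopes of the truncations for arbitrarily large truncation parameters is a
bound on the envelope of `Ψ`. -/
theorem qcEnvelope_le_of_frequently_linearTrunc {m n : ℕ} {q c : ℝ} (hq : 1 < q) (hc : 0 < c)
    {Ψ : Matrix (Fin m) (Fin n) ℝ → ℝ} (hΨ : Continuous Ψ)
    (hlower : ∀ ξ, max (1 / c * frobNorm ξ ^ q - c) 0 ≤ Ψ ξ)
    (hupper : ∀ ξ, Ψ ξ ≤ c * (frobNorm ξ ^ q + 1)) {ξ : Matrix (Fin m) (Fin n) ℝ} {L : ℝ}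
    (hL : ∃ᶠ K in atTop, qcEnvelope (linearTrunc Ψ q K) ξ ≤ L) : qcEnvelope Ψ ξ ≤ L := by
  have h0 : ∀ η, 0 ≤ Ψ η := fun η => (le_max_right _ _).trans (hlower η)
  refine (isLUB_qcEnvelope h0 ξ).2 ?_
  rintro _ ⟨Φ, hΦ, hle, rfl⟩
  refine le_of_forall_pos_le_add fun ε hε => ?_
  obtain ⟨K₀, hK₀⟩ := exists_forall_integral_le_linearTrunc hq hc hΨ hlower hupper ξ (L + ε / 2)
    (half_pos hε)
  obtain ⟨K, hKL, hK, hK0⟩ :=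
    (hL.and_eventually ((eventually_ge_atTop K₀).and (eventually_ge_atTop 0))).exists
  have hb : ∀ R : ℝ, ∃ C : ℝ, ∀ η, frobNorm η ≤ R → linearTrunc Ψ q K η ≤ C := fun R =>
    ⟨c * (R ^ q + 1), fun η hη => by
      refine (min_le_left _ _).trans ((hupper η).trans ?_)
      have := Real.rpow_le_rpow (frobNorm_nonneg η) hη (by linarith : 0 ≤ q)
      gcongr⟩
  have hle1 := testEnvelope_le_qcEnvelope (continuous_linearTrunc hΨ hq K)
    (linearTrunc_nonneg h0 hK0) hb ξ
  obtain ⟨φ, hφ, hφlt⟩ := exists_integral_lt_testEnvelope_add (linearTrunc Ψ q K) ξ (half_pos hε)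
  obtain ⟨ψ, hψ, hψle⟩ := hK₀ K hK φ hφ (by linarith)
  have := hΦ.le_integral_of_le hΨ hle ξ hψ
  linarith

theorem linearTrunc_le_mul_frobNorm_add_one {m n : ℕ} {q c : ℝ} (hq : 1 < q) (hc : 0 < c)
    {Ψ : Matrix (Fin m) (Fin n) ℝ → ℝ} (h0 : ∀ η, 0 ≤ Ψ η)
    (hupper : ∀ ξ, Ψ ξ ≤ c * (frobNorm ξ ^ q + 1)) {K : ℝ} (hK : 0 ≤ K)
    (ξ : Matrix (Fin m) (Fin n) ℝ) :
    linearTrunc Ψ q K ξ ≤ K * c ^ (1 / q) * (frobNorm ξ + 1) := by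
  have hq0 : 0 < q := by linarith
  have hf := frobNorm_nonneg ξ
  refine (min_le_right _ _).trans ?_
  rw [mul_assoc]
  gcongr
  have h1 : frobNorm ξ ^ q + 1 ≤ (frobNorm ξ + 1) ^ q := by
    have := Real.add_rpow_le_rpow_add hf zero_le_one hq.le
    rwa [Real.one_rpow] at this
  calc Ψ ξ ^ (1 / q) ≤ (c * (frobNorm ξ + 1) ^ q) ^ (1 / q) :=
        Real.rpow_le_rpow (h0 ξ) ((hupper ξ).trans (by gcongr)) (by positivity)
    _ = c ^ (1 / q) * (frobNorm ξ + 1) := by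
        rw [Real.mul_rpow hc.le (by positivity), ← Real.rpow_mul (by positivity),
          mul_one_div_cancel hq0.ne', Real.rpow_one]

/-- The factor `ℓ (1 - δ^{q'})^{1-p}` is increasing in `δ` and blows up at `δ = 1`. -/
theorem truncFactor_nonneg_monotoneOn_tendsto {q p ℓ : ℝ} (hq : 1 < q) (hp : 1 < p) (hℓ : 0 < ℓ) :
    (∀ δ ∈ Ioo (0 : ℝ) 1, 0 ≤ ℓ / (1 - δ ^ (q / (q - 1))) ^ (p - 1)) ∧
    MonotoneOn (fun δ : ℝ => ℓ / (1 - δ ^ (q / (q - 1))) ^ (p - 1)) (Ioo 0 1) ∧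
    Tendsto (fun δ : ℝ => ℓ / (1 - δ ^ (q / (q - 1))) ^ (p - 1)) (𝓝[<] 1) atTop := by
  have hr : 0 < q / (q - 1) := div_pos (by linarith) (by linarith)
  have hpos : ∀ δ ∈ Ioo (0 : ℝ) 1, 0 < 1 - δ ^ (q / (q - 1)) := fun δ hδ => by
    have := Real.rpow_lt_one hδ.1.le hδ.2 hr
    linarith
  have hpos' : ∀ δ ∈ Ioo (0 : ℝ) 1, 0 < (1 - δ ^ (q / (q - 1))) ^ (p - 1) := fun δ hδ =>
    Real.rpow_pos_of_pos (hpos δ hδ) _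
  refine ⟨fun δ hδ => (div_pos hℓ (hpos' δ hδ)).le, fun a ha b hb hab => ?_, ?_⟩
  · refine div_le_div_of_nonneg_left hℓ.le (hpos' b hb)
      (Real.rpow_le_rpow (hpos b hb).le ?_ (by linarith))
    have := Real.rpow_le_rpow ha.1.le hab hr.le
    linarith
  · simp only [div_eq_mul_inv ℓ]
    refine Tendsto.const_mul_atTop hℓ (tendsto_inv_nhdsGT_zero.comp
      (tendsto_nhdsWithin_iff.mpr ⟨?_, ?_⟩))
    · have hc : ContinuousAt (fun δ : ℝ => (1 - δ ^ (q / (q - 1))) ^ (p - 1)) 1 :=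
        (continuousAt_const.sub (continuousAt_id.rpow_const (Or.inl one_ne_zero))).rpow_const
          (Or.inr (by linarith))
      have := hc.tendsto
      simp only [Real.one_rpow, sub_self] at this
      rw [Real.zero_rpow (by linarith)] at this
      exact this.mono_left nhdsWithin_le_nhds
    · filter_upwards [Ioo_mem_nhdsLT (zero_lt_one' ℝ)] with δ hδ
      exact hpos' δ hδ

theorem mainTheorem10 {m n : ℕ} (q p ℓ c : ℝ) (hq : 1 < q) (hp : 1 < p) (hℓ : 0 < ℓ) (hc : 0 < c)
    (Ψ : Matrix (Fin m) (Fin n) ℝ → ℝ) (hΨ : Continuous Ψ)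
    (hlower : ∀ ξ, max (1 / c * frobNorm ξ ^ q - c) 0 ≤ Ψ ξ)
    (hupper : ∀ ξ, Ψ ξ ≤ c * (frobNorm ξ ^ q + 1)) :
    (∀ ξ,
      MonotoneOn (fun δ : ℝ => qcEnvelope (hDelta Ψ q p ℓ δ) ξ) (Set.Ioo 0 1) ∧
      IsLUB ((fun δ : ℝ => qcEnvelope (hDelta Ψ q p ℓ δ) ξ) '' Set.Ioo 0 1) (qcEnvelope Ψ ξ) ∧
      Tendsto (fun δ : ℝ => qcEnvelope (hDelta Ψ q p ℓ δ) ξ) (𝓝[<] 1) (𝓝 (qcEnvelope Ψ ξ))) ∧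
    (∀ δ ∈ Set.Ioo (0 : ℝ) 1, ∃ C : ℝ, ∀ ξ,
      0 ≤ qcEnvelope (hDelta Ψ q p ℓ δ) ξ ∧
      qcEnvelope (hDelta Ψ q p ℓ δ) ξ ≤ C * (frobNorm ξ + 1)) := by
  have h0 : ∀ η, 0 ≤ Ψ η := fun η => (le_max_right _ _).trans (hlower η)
  obtain ⟨hKpos, hKmono, hKlim⟩ := truncFactor_nonneg_monotoneOn_tendsto hq hp hℓ
  have hdef : ∀ δ, hDelta Ψ q p ℓ δ = linearTrunc Ψ q (ℓ / (1 - δ ^ (q / (q - 1))) ^ (p - 1)) :=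
    fun _ => rfl
  have hnn : ∀ δ ∈ Ioo (0 : ℝ) 1, ∀ η, 0 ≤ hDelta Ψ q p ℓ δ η := fun δ hδ η => by
    rw [hdef]
    exact linearTrunc_nonneg h0 (hKpos δ hδ) η
  refine ⟨fun ξ => ?_, fun δ hδ => ⟨_, fun ξ => ⟨qcEnvelope_nonneg (hnn δ hδ) ξ,
    (qcEnvelope_le (hnn δ hδ) ξ).trans
      (linearTrunc_le_mul_frobNorm_add_one hq hc h0 hupper (hKpos δ hδ) ξ)⟩⟩⟩
  have hmono : MonotoneOn (fun δ : ℝ => qcEnvelope (hDelta Ψ q p ℓ δ) ξ) (Ioo 0 1) := by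
    intro a ha b hb hab
    refine qcEnvelope_mono (hnn a ha) (fun η => min_le_min le_rfl ?_) ξ
    exact mul_le_mul_of_nonneg_right (hKmono ha hb hab) (Real.rpow_nonneg (h0 η) _)
  have hlub : IsLUB ((fun δ : ℝ => qcEnvelope (hDelta Ψ q p ℓ δ) ξ) '' Ioo 0 1)
      (qcEnvelope Ψ ξ) := by
    refine ⟨?_, fun L hL => ?_⟩
    · rintro _ ⟨δ, hδ, rfl⟩
      exact qcEnvelope_mono (hnn δ hδ) (fun η => min_le_left _ _) ξ
    · refine qcEnvelope_le_of_frequently_linearTrunc hq hc hΨ hlower hupper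
        (hKlim.frequently (Eventually.frequently ?_))
      filter_upwards [Ioo_mem_nhdsLT (zero_lt_one' ℝ)] with δ hδ
      exact hL ⟨δ, hδ, rfl⟩
  refine ⟨hmono, hlub, tendsto_order.2 ⟨fun a ha => ?_, fun a ha => ?_⟩⟩
  · obtain ⟨_, ⟨δ₀, hδ₀, rfl⟩, hlt, _⟩ := hlub.exists_between ha
    filter_upwards [Ioo_mem_nhdsLT hδ₀.2] with δ hδ
    exact hlt.trans_le (hmono hδ₀ ⟨hδ₀.1.trans hδ.1, hδ.2⟩ hδ.1.le)
  · filter_upwards [Ioo_mem_nhdsLT (zero_lt_one' ℝ)] with δ hδ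
    exact (hlub.1 ⟨δ, hδ, rfl⟩).trans_lt ha
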